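/- Let $R>0$, let $B_R\subset\mathbb R^3$ be the open ball of radius $R$ around the origin, and let $\mu\in C^\infty(\mathbb R_{\ge 0})$ be a cut-off function with $0\le\mu\le 1$, $\mu=1$ on $[0,2R]$, $\mu=0$ on $[4R,\infty)$, $|\mu'|\le C_\mu/R$ and $|\mu''|\le C_\mu/R^2$. Put $M(x):=\mu(\|x\|)$ and, for $\zeta\in\mathbb C$, $$G(\zeta,x):=\frac{e^{-\zeta\|x\|}}{4\pi\|x\|},\qquad x\in\mathbb R^3\setminus\{0\}.$$ For $\phi\in L^2(\mathbb R^3)$ supported in $B_R$ and $\operatorname{Re}\zeta\ge 0$ let $$z:=G(\overline\zeta)*\phi,\qquad z_\mu:=(G(\overline\zeta)M)*\phi .$$ Here $\|\cdot\|$ is the norm of $L^2(\mathbb R^3)$, $\|\nabla^p w\|:=\big(\sum_{|\alpha|=p}\tfrac{p!}{\alpha!}\|\partial^\alpha w\|^2\big)^{1/2}$ with weak derivatives, $\|w\|_{\rho}:=(\|\nabla w\|^2+\rho^2\|w\|^2)^{1/2}$, and $\hat w(\xi)=(2\pi)^{-3/2}\int_{\mathbb R^3} e^{-i\langle\xi,x\rangle}w(x)\,dx$,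 extended to $L^2(\mathbb R^3)$. All bounds include the assertion that the derivatives involved exist and lie in $L^2(\mathbb R^3)$. 1. Both convolution integrals converge absolutely at every point, and $z_\mu=z$ on $B_R$. 2. There is a constant $C>0$ depending only on $R$ and $\mu$ such that, for all $\phi\in L^2(\mathbb R^3)$ supported in $B_R$ and all $\zeta\in\mathbb C$ with $\operatorname{Re}\zeta\ge 0$, $$\|z_\mu\|_{|\zeta|}\le\frac{C}{1+\operatorname{Re}\zeta}\,\|\phi\| .$$ 3. For every $\lambda_0>1$ there is a constant $C'>0$ depending only on $\lambda_0$, $R$ and $\mu$ such that, for all $\phi\in L^2(\mathbb R^3)$ supported in $B_R$, all $\zeta$ with $\operatorname{Re}\zeta\ge0$ and $\operatorname{Im}\zeta\neq0$, and all $\lambda\ge\lambda_0$, there is a splitting $z_\mu=z_{H^2}+z_{\mathcal A}$ (depending on $\lambda$ and $\zeta$) with $z_{H^2},z_{\mathcal A}\in L^2(\mathbb R^3)$, $\widehat{z_{H^2}}(\xi)=0$ for almost every $\|\xi\|<\lambda|\operatorname{Im}\zeta|$, $\widehat{z_{\mathcal A}}(\xi)=0$ for almost every $\|\xi\|\ge\lambda|\operatorname{Im}\zeta|$,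 and $$\|\nabla^p z_{H^2}\|\le C'\,\frac{\lambda}{\lambda-1}\Big(\frac{|\zeta|}{\operatorname{Im}\zeta}\Big)^2(\lambda|\operatorname{Im}\zeta|)^{p-2}\,\|\phi\|\qquad\text{for } p\in\{0,1,2\},$$ $$\|\nabla^p z_{\mathcal A}\|\le C'\,\frac{1+|\zeta|}{1+\operatorname{Re}\zeta}\,(\sqrt3\,\lambda|\operatorname{Im}\zeta|)^{p-2}\,\|\phi\|\qquad\text{for all integers } p\ge 2,$$ $$\|\nabla^p z_{\mathcal A}\|\le C'\,\lambda^{2-p}\,\frac{1+|\zeta|}{1+\operatorname{Re}\zeta}\,(\sqrt3\,\lambda|\operatorname{Im}\zeta|)^{p-2}\,\|\phi\|\qquad\text{for } p\in\{0,1\}.$$ -/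

import Mathlib

open MeasureTheory FourierTransform LineDeriv SchwartzMap
open scoped ENNReal ContDiff

noncomputable section

namespace HelmholtzSplitting

/-- Three-dimensional Euclidean space. -/
abbrev E3 : Type := EuclideanSpace ℝ (Fin 3)

/-- The space `L²(ℝ³)` of complex-valued functions. -/
abbrev L2 : Type := Lp ℂ 2 (volume : Measure E3)

/-- A cut-off function `μ ∈ C^∞(ℝ_{≥0})` with `supp μ ⊆ [0, 4R]`, `μ = 1` on `[0, 2R]`,
`0 ≤ μ ≤ 1`, `|μ'| ≤ Cμ / R` and `|μ''| ≤ Cμ / R²`.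
Only the values of `μ` on `[0, ∞)` matter; derivatives are taken within `[0, ∞)`. -/
structure IsCutoff (R Cμ : ℝ) (μ : ℝ → ℝ) : Prop where
  contDiffOn : ContDiffOn ℝ ∞ μ (Set.Ici 0)
  nonneg : ∀ r, 0 ≤ r → 0 ≤ μ r
  le_one : ∀ r, 0 ≤ r → μ r ≤ 1
  eq_one : ∀ r, 0 ≤ r → r ≤ 2 * R → μ r = 1
  eq_zero : ∀ r, 4 * R ≤ r → μ r = 0
  deriv_le : ∀ r, 0 ≤ r → |derivWithin μ (Set.Ici 0) r| ≤ Cμ / R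
  deriv_two_le : ∀ r, 0 ≤ r → |iteratedDerivWithin 2 μ (Set.Ici 0) r| ≤ Cμ / R ^ 2

/-- The fundamental solution `G(ζ, x) = e^{-ζ‖x‖} / (4π‖x‖)` of `-Δ + ζ²` in `ℝ³`
(its value at the single point `0` is irrelevant). -/
def kernel (ζ : ℂ) (x : E3) : ℂ :=
  Complex.exp (-ζ * (‖x‖ : ℂ)) / (4 * (Real.pi : ℂ) * (‖x‖ : ℂ))

/-- The truncated kernel `G(ζ, ·) M`, where `M(x) = μ(‖x‖)`. -/
def cutKernel (μ : ℝ → ℝ) (ζ : ℂ) (x : E3) : ℂ :=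
  kernel ζ x * (μ ‖x‖ : ℂ)

/-- The convolution `(K * φ)(x) = ∫ φ(y) K(x - y) dy` over `ℝ³`. -/
def conv (K : E3 → ℂ) (φ : L2) : E3 → ℂ :=
  convolution (φ : E3 → ℂ) K (ContinuousLinearMap.mul ℂ ℂ) volume

/-- The integral that defines `(K * φ)(x)` converges absolutely for every `x`. -/
def ConvConverges (K : E3 → ℂ) (φ : L2) : Prop :=
  ConvolutionExists (φ : E3 → ℂ) K (ContinuousLinearMap.mul ℂ ℂ) volume

/-- `g i` is the `p`-th order partial derivative `∂_{i 0} ⋯ ∂_{i (p-1)} f` in the sense of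
(tempered) distributions, for each of the `3 ^ p` index tuples `i`. -/
def IsWeakGradient (p : ℕ) (f : L2) (g : (Fin p → Fin 3) → L2) : Prop :=
  ∀ i : Fin p → Fin 3,
    ∂^{fun j => (EuclideanSpace.single (i j) (1 : ℝ) : E3)} (f : 𝓢'(E3, ℂ)) = (g i : 𝓢'(E3, ℂ))

/-- `‖∇^p f‖ = (∑_{|α| = p} (p choose α) ‖∂^α f‖²)^{1/2}`, written as a sum over all index tuples
(each multi-index `α` arises from `p! / α!` tuples). The weak derivatives are unique, so the
infimum is over at most one `g`; it is `∞` if some derivative of order `p` is not in `L²`. -/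
def gradNorm (p : ℕ) (f : L2) : ℝ≥0∞ :=
  ⨅ (g : (Fin p → Fin 3) → L2) (_ : IsWeakGradient p f g),
    ENNReal.ofReal (Real.sqrt (∑ i, ‖g i‖ ^ 2))

/-- The weighted norm `‖f‖_ρ = (‖∇f‖² + ρ² ‖f‖²)^{1/2}`. -/
def weightedNorm (ρ : ℝ) (f : L2) : ℝ≥0∞ :=
  (gradNorm 1 f ^ 2 + ENNReal.ofReal (ρ ^ 2 * ‖f‖ ^ 2)) ^ (1 / 2 : ℝ)

/-- The Fourier transform of `f` vanishes at all frequencies `|ξ| ≥ δ`. Frequencies are angular,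
i.e. those of `e^{i⟨ξ, x⟩}`, whereas `𝓕` is normalised with `e^{-2πi⟨ξ, x⟩}`. -/
def IsLowFrequency (δ : ℝ) (f : L2) : Prop :=
  ∀ᵐ ξ : E3, δ ≤ 2 * Real.pi * ‖ξ‖ → (𝓕 f : L2) ξ = 0

/-- The Fourier transform of `f` vanishes at all (angular) frequencies `|ξ| < δ`. -/
def IsHighFrequency (δ : ℝ) (f : L2) : Prop :=
  ∀ᵐ ξ : E3, 2 * Real.pi * ‖ξ‖ < δ → (𝓕 f : L2) ξ = 0

/-- `φ` is supported in the ball `B_R(0)`. -/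
def SupportedInBall (R : ℝ) (φ : L2) : Prop :=
  ∀ᵐ x : E3, x ∉ Metric.ball (0 : E3) R → φ x = 0

end HelmholtzSplitting

end

/-!
For `q` vanishing at large radii, the Fourier transform of `q(‖x‖) / (4π‖x‖)` at a point of angular
frequency `k` is the sine transform `∫₀^∞ (sin (kr) / k) q(r) dr`: rotate the frequency onto the
first axis and integrate over the planes orthogonal to it. For `q(r) = e^{-sr} μ(r)` this is the
Laplace transform `σ(k)` at `s` of `(sin (kr) / k) μ(r)`, so `z_μ` is `φ` multiplied by `σ` on the
Fourier side. The Laplace transform is `O(1 / (1 + Re s))` on functions with a fixed bounded and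
integrable majorant, which settles `kσ(k)`. The rule `s L[f] = f(0) + L[f']` settles `sσ(k)`, and
applied twice gives `(k² + s²) σ(k) = μ(0) + L[2 cos (kr) μ'(r) + (sin (kr) / k) μ''(r)](s)`, which
is bounded. The splitting is the sharp frequency cut-off at `k = λ |Im ζ|`: above it,
`|k² + s²| ≥ k² (λ - 1) / λ`, and below it, the factors `k ≤ λ |Im ζ|` account for the derivatives.
-/

noncomputable section

namespace HelmholtzSplitting

section Fourier

theorem hasTemperateGrowth_prod {ι E A : Type*} [NormedAddCommGroup E] [NormedSpace ℝ E]
    [NormedCommRing A] [NormedAlgebra ℝ A] {s : Finset ι} {g : ι → E → A}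
    (h : ∀ i ∈ s, (g i).HasTemperateGrowth) :
    Function.HasTemperateGrowth fun ξ => ∏ i ∈ s, g i ξ := by
  induction s using Finset.cons_induction with
  | empty => simp
  | cons i s hi ih =>
    simp_rw [Finset.prod_cons]
    exact (h i (Finset.mem_cons_self i s)).mul
      (ih fun j hj => h j (Finset.mem_cons_of_mem hj))

variable {E F : Type*} [NormedAddCommGroup E] [InnerProductSpace ℝ E] [FiniteDimensional ℝ E]
  [MeasurableSpace E] [BorelSpace E]

theorem fourier_iteratedLineDerivOp [NormedAddCommGroup F] [NormedSpace ℂ F] {p : ℕ}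
    (m : Fin p → E) (T : 𝓢'(E, F)) :
    𝓕 (∂^{m} T) = TemperedDistribution.smulLeftCLM F
      (fun ξ => ∏ j, (2 * Real.pi * Complex.I) * (inner ℝ ξ (m j) : ℂ)) (𝓕 T) := by
  induction p with
  | zero => simp
  | succ p ih =>
    have h_head : Function.HasTemperateGrowth fun ξ => (inner ℝ ξ (m 0) : ℂ) := by fun_prop
    have h_tail : Function.HasTemperateGrowth fun ξ => ∏ j : Fin p,
        (2 * Real.pi * Complex.I) * (inner ℝ ξ (Fin.tail m j) : ℂ) :=
      hasTemperateGrowth_prod fun j _ => by fun_prop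
    rw [iteratedLineDerivOp_succ_left, TemperedDistribution.fourier_lineDerivOp_eq, ih,
      TemperedDistribution.smulLeftCLM_smulLeftCLM_apply h_tail h_head, ← smul_apply,
      ← TemperedDistribution.smulLeftCLM_smul (h_tail.mul h_head)]
    congr 2
    ext ξ
    simp only [Pi.smul_apply, Pi.mul_apply, smul_eq_mul, Fin.prod_univ_succ, Fin.tail]
    ring

variable [NormedAddCommGroup F] [InnerProductSpace ℂ F] [CompleteSpace F] {f : E → F}

theorem integral_smul_fourier_toLp (hf : Integrable f) (hf₂ : MemLp f 2) (u : 𝓢(E, ℂ)) :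
    ∫ ξ, u ξ • (𝓕 hf₂.toLp : Lp F 2 (volume : Measure E)) ξ = ∫ ξ, u ξ • 𝓕 f ξ :=
  calc ∫ ξ, u ξ • (𝓕 hf₂.toLp : Lp F 2 (volume : Measure E)) ξ
      = ∫ x, (𝓕 u) x • hf₂.toLp f x := by
        rw [← Lp.toTemperedDistribution_apply, ← Lp.fourier_toTemperedDistribution_eq,
          TemperedDistribution.fourier_apply, Lp.toTemperedDistribution_apply]
    _ = ∫ x, 𝓕 (u : E → ℂ) x • f x := by
        rw [SchwartzMap.fourier_coe]
        exact integral_congr_ae (hf₂.coeFn_toLp.mono fun x hx => by simp only [hx])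
    _ = ∫ ξ, u ξ • 𝓕 f ξ := by
        have h := VectorFourier.integral_fourierIntegral_smul_eq_flip (L := innerₗ E)
          Real.continuous_fourierChar continuous_inner (u.integrable (μ := volume)) hf
        rwa [flip_innerₗ] at h

theorem fourier_toLp_ae_eq (hf : Integrable f) (hf₂ : MemLp f 2) :
    (𝓕 hf₂.toLp : Lp F 2 (volume : Measure E)) =ᵐ[volume] 𝓕 f := by
  have h_cont : Continuous (𝓕 f) :=
    VectorFourier.fourierIntegral_continuous Real.continuous_fourierChar continuous_inner hf
  refine ae_eq_of_integral_contDiff_smul_eq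
    ((Lp.memLp _).locallyIntegrable (by norm_num)) h_cont.locallyIntegrable
    fun g g_smooth g_supp => ?_
  have hu_supp : HasCompactSupport (Complex.ofRealCLM ∘ g) := g_supp.comp_left rfl
  have hu_smooth : ContDiff ℝ ∞ (Complex.ofRealCLM ∘ g) := by fun_prop
  simpa [Complex.coe_smul] using
    integral_smul_fourier_toLp hf hf₂ (hu_supp.toSchwartzMap hu_smooth)

end Fourier

section SquareIntegrable

variable {α F : Type*} [MeasurableSpace α] {ν : Measure α} [NormedAddCommGroup F]

theorem integrable_norm_sq (f : Lp F 2 ν) : Integrable (fun x => ‖f x‖ ^ 2) ν :=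
  (Lp.memLp f).integrable_norm_pow (by norm_num)

theorem norm_sq_eq_integral (f : Lp F 2 ν) : ‖f‖ ^ 2 = ∫ x, ‖f x‖ ^ 2 ∂ν := by
  have h_nonneg : 0 ≤ ∫ x, ‖f x‖ ^ 2 ∂ν := integral_nonneg fun x => by positivity
  rw [Lp.norm_def, (Lp.memLp f).eLpNorm_eq_integral_rpow_norm (by norm_num) (by norm_num)]
  simp only [ENNReal.toReal_ofNat, Real.rpow_two]
  rw [ENNReal.toReal_ofReal (by positivity), ← Real.rpow_natCast, ← Real.rpow_mul h_nonneg]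
  norm_num

end SquareIntegrable

section WeakDerivatives

variable {ι : Type*} {p : ℕ}

/-- The Fourier symbol of the iterated partial derivative `∂_{i 0} ⋯ ∂_{i (p-1)}`, for the
normalisation `e^{-2πi⟨ξ, x⟩}` of `𝓕`. -/
def derivSymbol (i : Fin p → ι) (ξ : EuclideanSpace ℝ ι) : ℂ :=
  ∏ j, (2 * Real.pi * Complex.I) * (ξ (i j) : ℂ)

theorem continuous_derivSymbol (i : Fin p → ι) : Continuous (derivSymbol i) := by
  unfold derivSymbol
  fun_prop

variable [Fintype ι]

theorem sum_norm_derivSymbol_sq (p : ℕ) (ξ : EuclideanSpace ℝ ι) :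
    ∑ i : Fin p → ι, ‖derivSymbol i ξ‖ ^ 2 = ((2 * Real.pi * ‖ξ‖) ^ p) ^ 2 := by
  have h_prod (i : Fin p → ι) :
      ‖derivSymbol i ξ‖ ^ 2 = ∏ j, ((2 * Real.pi) ^ 2 * ‖ξ (i j)‖ ^ 2) := by
    simp [derivSymbol, ← Finset.prod_pow, mul_pow]
  simp_rw [h_prod]
  rw [← Fintype.sum_pow (fun a => (2 * Real.pi) ^ 2 * ‖ξ a‖ ^ 2) p, ← Finset.mul_sum,
    ← EuclideanSpace.norm_sq_eq, ← mul_pow, pow_right_comm]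

theorem norm_derivSymbol_le (i : Fin p → ι) (ξ : EuclideanSpace ℝ ι) :
    ‖derivSymbol i ξ‖ ≤ (2 * Real.pi * ‖ξ‖) ^ p := by
  apply le_of_sq_le_sq _ (by positivity)
  rw [← sum_norm_derivSymbol_sq]
  exact Finset.single_le_sum (f := fun i : Fin p → ι => ‖derivSymbol i ξ‖ ^ 2)
    (fun _ _ => sq_nonneg _) (Finset.mem_univ i)

variable {f : L2} {g : (Fin p → Fin 3) → L2}

theorem isWeakGradient_of_fourier
    (hg : ∀ i, (𝓕 (g i) : L2) =ᵐ[volume] fun ξ => derivSymbol i ξ * (𝓕 f : L2) ξ) :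
    IsWeakGradient p f g := by
  intro i
  apply (fourierEquiv ℂ 𝓢'(E3, ℂ)).injective
  simp only [fourierEquiv_apply]
  rw [fourier_iteratedLineDerivOp, Lp.fourier_toTemperedDistribution_eq,
    Lp.fourier_toTemperedDistribution_eq]
  ext u
  have h_growth : Function.HasTemperateGrowth fun ξ : E3 => ∏ j : Fin p,
      (2 * Real.pi * Complex.I) * (inner ℝ ξ (EuclideanSpace.single (i j) (1 : ℝ)) : ℂ) :=
    hasTemperateGrowth_prod fun j _ => by fun_prop
  rw [TemperedDistribution.smulLeftCLM_apply_apply, Lp.toTemperedDistribution_apply,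
    Lp.toTemperedDistribution_apply]
  refine integral_congr_ae ((hg i).mono fun ξ hξ => ?_)
  simp only [hξ, SchwartzMap.smulLeftCLM_apply_apply h_growth]
  simp only [derivSymbol, EuclideanSpace.inner_single_right, smul_eq_mul, one_mul, conj_trivial]
  ring

theorem sum_norm_sq_of_fourier
    (hg : ∀ i, (𝓕 (g i) : L2) =ᵐ[volume] fun ξ => derivSymbol i ξ * (𝓕 f : L2) ξ) :
    ∑ i, ‖g i‖ ^ 2 = ∫ ξ, ‖((2 * Real.pi * ‖ξ‖) ^ p) • (𝓕 f : L2) ξ‖ ^ 2 := by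
  have h_norm (i : Fin p → Fin 3) : ‖g i‖ ^ 2 = ∫ ξ, ‖(𝓕 (g i) : L2) ξ‖ ^ 2 := by
    rw [← norm_sq_eq_integral, Lp.norm_fourier_eq]
  simp_rw [h_norm]
  rw [← integral_finsetSum _ fun i _ => integrable_norm_sq (𝓕 (g i) : L2)]
  refine integral_congr_ae ((ae_all_iff.2 hg).mono fun ξ hξ => ?_)
  simp only [hξ, norm_mul, norm_smul, mul_pow, ← Finset.sum_mul, sum_norm_derivSymbol_sq,
    Real.norm_eq_abs, sq_abs]

theorem gradNorm_le_norm_toLp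
    (hf : MemLp (fun ξ : E3 => ((2 * Real.pi * ‖ξ‖) ^ p) • (𝓕 f : L2) ξ) 2) :
    gradNorm p f ≤ ENNReal.ofReal ‖hf.toLp‖ := by
  have h_memLp (i : Fin p → Fin 3) : MemLp (fun ξ => derivSymbol i ξ * (𝓕 f : L2) ξ) 2 := by
    refine hf.of_le ((continuous_derivSymbol i).aestronglyMeasurable.mul
      (Lp.aestronglyMeasurable _)) (.of_forall fun ξ => ?_)
    rw [norm_mul, norm_smul]
    gcongr
    exact (norm_derivSymbol_le i ξ).trans (Real.le_norm_self _)
  let g (i : Fin p → Fin 3) : L2 := 𝓕⁻ (h_memLp i).toLp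
  have hg (i : Fin p → Fin 3) :
      (𝓕 (g i) : L2) =ᵐ[volume] fun ξ => derivSymbol i ξ * (𝓕 f : L2) ξ := by
    rw [fourier_fourierInv_eq]
    exact (h_memLp i).coeFn_toLp
  have h_norm : Real.sqrt (∑ i, ‖g i‖ ^ 2) = ‖hf.toLp‖ := by
    rw [sum_norm_sq_of_fourier hg, ← Real.sqrt_sq (norm_nonneg hf.toLp), norm_sq_eq_integral]
    congr 1
    exact integral_congr_ae (hf.coeFn_toLp.mono fun ξ hξ => by simp only [hξ])
  exact (iInf₂_le g (isWeakGradient_of_fourier hg)).trans_eq (by rw [h_norm])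

theorem weightedNorm_le {ρ A B : ℝ} (hA : 0 ≤ A) (hB : 0 ≤ B)
    (h_grad : gradNorm 1 f ≤ ENNReal.ofReal A) (h_norm : |ρ| * ‖f‖ ≤ B) :
    weightedNorm ρ f ≤ ENNReal.ofReal (A + B) := by
  have h_norm_sq : ρ ^ 2 * ‖f‖ ^ 2 ≤ B ^ 2 := by
    rw [← sq_abs ρ, ← mul_pow]
    gcongr
  calc weightedNorm ρ f
      ≤ (ENNReal.ofReal A ^ 2 + ENNReal.ofReal (B ^ 2)) ^ (1 / 2 : ℝ) := by
        unfold weightedNorm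
        gcongr
    _ ≤ (ENNReal.ofReal (A + B) ^ 2) ^ (1 / 2 : ℝ) := by
        rw [← ENNReal.ofReal_pow hA, ← ENNReal.ofReal_add (by positivity) (by positivity),
          ← ENNReal.ofReal_pow (by positivity)]
        gcongr
        exact pow_add_pow_le hA hB two_ne_zero
    _ = ENNReal.ofReal (A + B) := by
        rw [← ENNReal.rpow_natCast, ← ENNReal.rpow_mul]
        norm_num

end WeakDerivatives

section RadialMultipliers

/-- `z` is the image of `φ` under the Fourier multiplier with radial symbol `ξ ↦ σ |ξ|`. As in
`IsLowFrequency`, the argument of `σ` is the angular frequency `2π‖ξ‖`. -/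
def HasRadialSymbol (σ : ℝ → ℂ) (φ z : L2) : Prop :=
  ∀ᵐ ξ : E3, (𝓕 z : L2) ξ = σ (2 * Real.pi * ‖ξ‖) * (𝓕 φ : L2) ξ

theorem ae_angularFrequency_pos : ∀ᵐ ξ : E3, 0 < 2 * Real.pi * ‖ξ‖ := by
  filter_upwards [Measure.ae_ne volume (0 : E3)] with ξ hξ
  positivity

theorem measurableSet_angularFrequency {T : Set ℝ} (hT : MeasurableSet T) :
    MeasurableSet {ξ : E3 | 2 * Real.pi * ‖ξ‖ ∈ T} :=
  measurableSet_preimage (by fun_prop) hT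

/-- The part of `f` with angular frequencies in `T`. -/
def bandPass (T : Set ℝ) (hT : MeasurableSet T) (f : L2) : L2 :=
  𝓕⁻ ((Lp.memLp (𝓕 f : L2)).indicator (measurableSet_angularFrequency hT)).toLp

variable {T : Set ℝ} (hT : MeasurableSet T)

theorem fourier_bandPass (f : L2) :
    (𝓕 (bandPass T hT f) : L2) =ᵐ[volume]
      {ξ : E3 | 2 * Real.pi * ‖ξ‖ ∈ T}.indicator (𝓕 f : L2) := by
  rw [bandPass, fourier_fourierInv_eq]
  exact MemLp.coeFn_toLp _

theorem bandPass_add_bandPass_compl (f : L2) :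
    bandPass T hT f + bandPass Tᶜ hT.compl f = f := by
  apply (fourierEquiv ℂ L2).injective
  simp only [fourierEquiv_apply]
  rw [FourierTransform.fourier_add]
  ext1
  filter_upwards [Lp.coeFn_add (𝓕 (bandPass T hT f)) (𝓕 (bandPass Tᶜ hT.compl f)),
    fourier_bandPass hT f, fourier_bandPass hT.compl f] with ξ h_add hξ hξ'
  rw [h_add, Pi.add_apply, hξ, hξ']
  exact Set.indicator_self_add_compl_apply _ _ ξ

namespace HasRadialSymbol

variable {σ : ℝ → ℂ} {φ z : L2} {p : ℕ} {B δ : ℝ}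

theorem bandPass (h : HasRadialSymbol σ φ z) :
    HasRadialSymbol (T.indicator σ) φ (bandPass T hT z) := by
  filter_upwards [h, fourier_bandPass hT z] with ξ hξ h_band
  by_cases hmem : 2 * Real.pi * ‖ξ‖ ∈ T <;> simp [h_band, hmem, hξ]

theorem isHighFrequency (h : HasRadialSymbol σ φ z) (hσ : ∀ k < δ, σ k = 0) :
    IsHighFrequency δ z :=
  h.mono fun ξ hξ hlt => by rw [hξ, hσ _ hlt, zero_mul]

theorem isLowFrequency (h : HasRadialSymbol σ φ z) (hσ : ∀ k, δ ≤ k → σ k = 0) :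
    IsLowFrequency δ z :=
  h.mono fun ξ hξ hle => by rw [hξ, hσ _ hle, zero_mul]

theorem norm_mul_norm_le (h : HasRadialSymbol σ φ z) {c : ℂ}
    (hσ : ∀ k, 0 < k → ‖c‖ * ‖σ k‖ ≤ B) : ‖c‖ * ‖z‖ ≤ B * ‖φ‖ := by
  have h_ae : ∀ᵐ ξ : E3, ‖(c • (𝓕 z : L2)) ξ‖ ≤ B * ‖(𝓕 φ : L2) ξ‖ := by
    filter_upwards [h, ae_angularFrequency_pos, Lp.coeFn_smul c (𝓕 z : L2)]
      with ξ hξ hpos h_smul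
    rw [h_smul, Pi.smul_apply, norm_smul, hξ, norm_mul, ← mul_assoc]
    gcongr
    exact hσ _ hpos
  simpa only [norm_smul, Lp.norm_fourier_eq] using Lp.norm_le_mul_norm_of_ae_le_mul h_ae

theorem gradNorm_le (h : HasRadialSymbol σ φ z) (hσ : ∀ k, 0 < k → k ^ p * ‖σ k‖ ≤ B) :
    gradNorm p z ≤ ENNReal.ofReal (B * ‖φ‖) := by
  have h_ae : ∀ᵐ ξ : E3, ‖((2 * Real.pi * ‖ξ‖) ^ p) • (𝓕 z : L2) ξ‖ ≤ B * ‖(𝓕 φ : L2) ξ‖ := by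
    filter_upwards [h, ae_angularFrequency_pos] with ξ hξ hpos
    rw [norm_smul, hξ, norm_mul, ← mul_assoc, Real.norm_of_nonneg (by positivity)]
    gcongr
    exact hσ _ hpos
  have h_memLp : MemLp (fun ξ : E3 => ((2 * Real.pi * ‖ξ‖) ^ p) • (𝓕 z : L2) ξ) 2 :=
    (Lp.memLp (𝓕 φ : L2)).of_le_mul
      ((by fun_prop : Continuous fun ξ : E3 => (2 * Real.pi * ‖ξ‖) ^ p).aestronglyMeasurable.smul
        (Lp.aestronglyMeasurable _)) h_ae
  refine (gradNorm_le_norm_toLp h_memLp).trans (ENNReal.ofReal_le_ofReal ?_)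
  rw [← Lp.norm_fourier_eq φ]
  apply Lp.norm_le_mul_norm_of_ae_le_mul
  filter_upwards [h_ae, h_memLp.coeFn_toLp] with ξ hξ h_coe
  rwa [h_coe]

theorem gradNorm_bandPass_le (h : HasRadialSymbol σ φ z) (hB : 0 ≤ B)
    (hσ : ∀ k ∈ T, 0 < k → k ^ p * ‖σ k‖ ≤ B) :
    gradNorm p (HelmholtzSplitting.bandPass T hT z) ≤ ENNReal.ofReal (B * ‖φ‖) :=
  (h.bandPass hT).gradNorm_le fun k hk => by
    by_cases hmem : k ∈ T <;> simp [hmem, hσ, hk, hB]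

end HasRadialSymbol

end RadialMultipliers

section ResolventSymbols

/-- The bounds that the splitting needs from an approximation `σ` of the symbol
`k ↦ (k² + s²)⁻¹` of the resolvent `(-Δ + s²)⁻¹`; they are uniform up to the imaginary axis, where
the symbol itself is singular at `k = |s|`. -/
structure IsResolventSymbol (C : ℝ) (s : ℂ) (σ : ℝ → ℂ) : Prop where
  mul_norm_le : ∀ k, 0 < k → k * ‖σ k‖ ≤ C / (1 + s.re)
  norm_mul_norm_le : ∀ k, 0 < k → ‖s‖ * ‖σ k‖ ≤ C / (1 + s.re)
  norm_sq_add_sq_mul_le : ∀ k : ℝ, 0 < k → ‖((k : ℂ) ^ 2 + s ^ 2) * σ k‖ ≤ C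

theorem sq_mul_le_norm_sq_add_sq {s : ℂ} {k lam : ℝ} (hlam : 1 < lam) (hk : lam * |s.im| ≤ k) :
    k ^ 2 * ((lam - 1) / lam) ≤ ‖(k : ℂ) ^ 2 + s ^ 2‖ := by
  have hlam_pos : 0 < lam := one_pos.trans hlam
  have h_fac : (k : ℂ) ^ 2 + s ^ 2 = (k + Complex.I * s) * (k - Complex.I * s) := by
    linear_combination s ^ 2 * Complex.I_sq
  have h_re : |k - s.im| ≤ ‖k + Complex.I * s‖ ∧ |k + s.im| ≤ ‖k - Complex.I * s‖ := by
    constructor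
    · simpa [sub_eq_add_neg] using Complex.abs_re_le_norm (k + Complex.I * s)
    · simpa using Complex.abs_re_le_norm (k - Complex.I * s)
  have h_sq : (lam * |s.im|) ^ 2 ≤ k ^ 2 := pow_le_pow_left₀ (by positivity) hk 2
  calc k ^ 2 * ((lam - 1) / lam)
      ≤ k ^ 2 - s.im ^ 2 := by
        rw [mul_div_assoc', div_le_iff₀ hlam_pos]
        rw [mul_pow, sq_abs] at h_sq
        nlinarith
    _ ≤ |k - s.im| * |k + s.im| := by
        rw [← abs_mul]
        exact (by ring : k ^ 2 - s.im ^ 2 = (k - s.im) * (k + s.im)).trans_le (le_abs_self _)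
    _ ≤ ‖(k : ℂ) ^ 2 + s ^ 2‖ := by
        rw [h_fac, norm_mul]
        exact mul_le_mul h_re.1 h_re.2 (abs_nonneg _) (norm_nonneg _)

theorem zpow_le_zpow_left_of_nonpos {a b : ℝ} {n : ℤ} (ha : 0 < a) (hab : a ≤ b) (hn : n ≤ 0) :
    b ^ n ≤ a ^ n := by
  simpa only [zpow_neg, inv_inv] using
    inv_anti₀ (zpow_pos ha (-n)) (zpow_le_zpow_left₀ (neg_nonneg.2 hn) ha.le hab)

theorem pow_eq_zpow_mul_sq {k : ℝ} (hk : k ≠ 0) (p : ℕ) : k ^ p = k ^ ((p : ℤ) - 2) * k ^ 2 := by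
  rw [← zpow_natCast k 2, ← zpow_add₀ hk, Nat.cast_two, sub_add_cancel, zpow_natCast]

namespace IsResolventSymbol

variable {C : ℝ} {s : ℂ} {σ : ℝ → ℂ} {k lam : ℝ} {p : ℕ}

theorem nonneg (h : IsResolventSymbol C s σ) : 0 ≤ C :=
  (norm_nonneg _).trans (h.norm_sq_add_sq_mul_le 1 one_pos)

theorem sq_mul_norm_le_of_high (h : IsResolventSymbol C s σ) (hlam : 1 < lam) (hk₀ : 0 < k)
    (hk : lam * |s.im| ≤ k) : k ^ 2 * ‖σ k‖ ≤ C * (lam / (lam - 1)) := by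
  have h_pos : 0 < (lam - 1) / lam := div_pos (sub_pos.2 hlam) (one_pos.trans hlam)
  rw [← inv_div (lam - 1), ← div_eq_mul_inv, le_div_iff₀ h_pos]
  calc k ^ 2 * ‖σ k‖ * ((lam - 1) / lam)
      = k ^ 2 * ((lam - 1) / lam) * ‖σ k‖ := mul_right_comm _ _ _
    _ ≤ ‖(k : ℂ) ^ 2 + s ^ 2‖ * ‖σ k‖ := by gcongr; exact sq_mul_le_norm_sq_add_sq hlam hk
    _ ≤ C := (norm_mul _ _).symm.trans_le (h.norm_sq_add_sq_mul_le k hk₀)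

theorem sq_mul_norm_le (h : IsResolventSymbol C s σ) (hs : 0 ≤ s.re) (hk : 0 < k) :
    k ^ 2 * ‖σ k‖ ≤ 2 * C * ((1 + ‖s‖) / (1 + s.re)) := by
  have hC := h.nonneg
  have h_one_le : 1 ≤ (1 + ‖s‖) / (1 + s.re) := by
    rw [one_le_div (by positivity)]
    gcongr
    exact Complex.re_le_norm s
  calc k ^ 2 * ‖σ k‖ = ‖((k : ℂ) ^ 2 + s ^ 2) * σ k - s ^ 2 * σ k‖ := by
        rw [add_mul, add_sub_cancel_right, norm_mul, norm_pow, Complex.norm_of_nonneg hk.le]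
    _ ≤ C + ‖s‖ * (‖s‖ * ‖σ k‖) := by
        rw [← mul_assoc, ← sq, ← norm_pow, ← norm_mul (s ^ 2)]
        exact norm_sub_le_of_le (h.norm_sq_add_sq_mul_le k hk) le_rfl
    _ ≤ C * ((1 + ‖s‖) / (1 + s.re)) + (1 + ‖s‖) * (C / (1 + s.re)) := by
        gcongr
        · exact le_mul_of_one_le_right hC h_one_le
        · exact le_add_of_nonneg_left zero_le_one
        · exact h.norm_mul_norm_le k hk
    _ = 2 * C * ((1 + ‖s‖) / (1 + s.re)) := by ring

theorem pow_mul_norm_le_of_le_one (h : IsResolventSymbol C s σ) (hs : 0 ≤ s.re) (hs₀ : s ≠ 0)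
    (hk : 0 < k) (hp : p ≤ 1) :
    k ^ p * ‖σ k‖ ≤ C * ((1 + ‖s‖) / (1 + s.re)) * ‖s‖ ^ ((p : ℤ) - 2) := by
  have hs_pos : 0 < ‖s‖ := norm_pos_iff.2 hs₀
  have hC := h.nonneg
  have h_div (x : ℝ) (hx : x ≤ C / (1 + s.re)) : ‖s‖ * x ≤ C * ((1 + ‖s‖) / (1 + s.re)) :=
    calc ‖s‖ * x ≤ ‖s‖ * (C / (1 + s.re)) := by gcongr
      _ ≤ (1 + ‖s‖) * (C / (1 + s.re)) := by gcongr; exact le_add_of_nonneg_left zero_le_one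
      _ = C * ((1 + ‖s‖) / (1 + s.re)) := by ring
  interval_cases p
  · rw [Nat.cast_zero, zero_sub, zpow_neg, ← div_eq_mul_inv, le_div_iff₀ (by positivity)]
    calc k ^ 0 * ‖σ k‖ * ‖s‖ ^ (2 : ℤ) = ‖s‖ * (‖s‖ * ‖σ k‖) := by rw [zpow_ofNat]; ring
      _ ≤ C * ((1 + ‖s‖) / (1 + s.re)) := h_div _ (h.norm_mul_norm_le k hk)
  · rw [Nat.cast_one, show (1 : ℤ) - 2 = -1 by norm_num, zpow_neg_one, ← div_eq_mul_inv,
      le_div_iff₀ hs_pos]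
    calc k ^ 1 * ‖σ k‖ * ‖s‖ = ‖s‖ * (k * ‖σ k‖) := by ring
      _ ≤ C * ((1 + ‖s‖) / (1 + s.re)) := h_div _ (h.mul_norm_le k hk)

theorem pow_mul_norm_le_of_high (h : IsResolventSymbol C s σ) (him : s.im ≠ 0) (hlam : 1 < lam)
    (hk : lam * |s.im| ≤ k) (hp : p ≤ 2) :
    k ^ p * ‖σ k‖ ≤
      C * (lam / (lam - 1)) * (‖s‖ / s.im) ^ 2 * (lam * |s.im|) ^ ((p : ℤ) - 2) := by
  have hδ : 0 < lam * |s.im| := by positivity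
  have hC := h.nonneg
  have : 0 < lam - 1 := sub_pos.2 hlam
  have h_ratio : 1 ≤ (‖s‖ / s.im) ^ 2 := by
    rw [← sq_abs, abs_div, abs_norm]
    exact one_le_pow₀ ((one_le_div (abs_pos.2 him)).2 (Complex.abs_im_le_norm s))
  calc k ^ p * ‖σ k‖ = k ^ 2 * ‖σ k‖ * k ^ ((p : ℤ) - 2) := by
        rw [pow_eq_zpow_mul_sq (hδ.trans_le hk).ne' p]
        ring
    _ ≤ C * (lam / (lam - 1)) * (lam * |s.im|) ^ ((p : ℤ) - 2) := by
        gcongr ?_ * ?_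
        · exact zpow_nonneg (hδ.trans_le hk).le _
        · exact h.sq_mul_norm_le_of_high hlam (hδ.trans_le hk) hk
        · exact zpow_le_zpow_left_of_nonpos hδ hk (by lia)
    _ ≤ C * (lam / (lam - 1)) * (‖s‖ / s.im) ^ 2 * (lam * |s.im|) ^ ((p : ℤ) - 2) := by
        gcongr ?_ * _
        exact le_mul_of_one_le_right (by positivity) h_ratio

theorem pow_mul_norm_le_of_low (h : IsResolventSymbol C s σ) (hs : 0 ≤ s.re) (hk₀ : 0 < k)
    (hk : k ≤ lam * |s.im|) (hp : 2 ≤ p) :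
    k ^ p * ‖σ k‖ ≤ 2 * C * ((1 + ‖s‖) / (1 + s.re)) *
      (Real.sqrt 3 * lam * |s.im|) ^ ((p : ℤ) - 2) := by
  have hC := h.nonneg
  have h_sqrt : 1 ≤ Real.sqrt 3 := Real.one_le_sqrt.2 (by norm_num)
  calc k ^ p * ‖σ k‖ = k ^ 2 * ‖σ k‖ * k ^ ((p : ℤ) - 2) := by
        rw [pow_eq_zpow_mul_sq hk₀.ne' p]
        ring
    _ ≤ 2 * C * ((1 + ‖s‖) / (1 + s.re)) *
          (Real.sqrt 3 * lam * |s.im|) ^ ((p : ℤ) - 2) := by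
        gcongr ?_ * ?_
        · exact h.sq_mul_norm_le hs hk₀
        · refine zpow_le_zpow_left₀ (by lia) hk₀.le (hk.trans ?_)
          rw [mul_assoc]
          exact le_mul_of_one_le_left (hk₀.le.trans hk) h_sqrt

theorem pow_mul_norm_le_of_low_of_le_one (h : IsResolventSymbol C s σ) (hs : 0 ≤ s.re)
    (him : s.im ≠ 0) (hlam : 0 < lam) (hk : 0 < k) (hp : p ≤ 1) :
    k ^ p * ‖σ k‖ ≤ 3 * C * lam ^ (2 - (p : ℤ)) * ((1 + ‖s‖) / (1 + s.re)) *
      (Real.sqrt 3 * lam * |s.im|) ^ ((p : ℤ) - 2) := by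
  have hC := h.nonneg
  have h_im : 0 < |s.im| := abs_pos.2 him
  have hs₀ : s ≠ 0 := fun h => him (by rw [h, Complex.zero_im])
  have h_lam : lam ^ (2 - (p : ℤ)) * lam ^ ((p : ℤ) - 2) = 1 := by
    rw [← zpow_add₀ hlam.ne', sub_add_sub_cancel, sub_self, zpow_zero]
  have h_sqrt : 1 ≤ 3 * Real.sqrt 3 ^ ((p : ℤ) - 2) :=
    calc (1 : ℝ) ≤ Real.sqrt 3 ^ p := one_le_pow₀ (Real.one_le_sqrt.2 (by norm_num))
      _ = 3 * Real.sqrt 3 ^ ((p : ℤ) - 2) := by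
        rw [pow_eq_zpow_mul_sq (by positivity) p, Real.sq_sqrt (by norm_num), mul_comm]
  calc k ^ p * ‖σ k‖ ≤ C * ((1 + ‖s‖) / (1 + s.re)) * ‖s‖ ^ ((p : ℤ) - 2) :=
        h.pow_mul_norm_le_of_le_one hs hs₀ hk hp
    _ ≤ C * ((1 + ‖s‖) / (1 + s.re)) * |s.im| ^ ((p : ℤ) - 2) := by
        gcongr
        exact zpow_le_zpow_left_of_nonpos h_im (Complex.abs_im_le_norm s) (by lia)
    _ ≤ C * ((1 + ‖s‖) / (1 + s.re)) * |s.im| ^ ((p : ℤ) - 2) *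
          (3 * Real.sqrt 3 ^ ((p : ℤ) - 2)) := le_mul_of_one_le_right (by positivity) h_sqrt
    _ = _ := by
        rw [mul_zpow, mul_zpow]
        linear_combination -(3 * C * ((1 + ‖s‖) / (1 + s.re)) * |s.im| ^ ((p : ℤ) - 2) *
          Real.sqrt 3 ^ ((p : ℤ) - 2)) * h_lam

end IsResolventSymbol

namespace HasRadialSymbol

variable {C : ℝ} {s : ℂ} {σ : ℝ → ℂ} {φ z : L2}

theorem weightedNorm_le (h : HasRadialSymbol σ φ z) (hσ : IsResolventSymbol C s σ)
    (hs : 0 ≤ s.re) : weightedNorm ‖s‖ z ≤ ENNReal.ofReal (2 * C / (1 + s.re) * ‖φ‖) := by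
  have hC := hσ.nonneg
  have h_grad : gradNorm 1 z ≤ ENNReal.ofReal (C / (1 + s.re) * ‖φ‖) :=
    h.gradNorm_le fun k hk => by simpa only [pow_one] using hσ.mul_norm_le k hk
  refine (HelmholtzSplitting.weightedNorm_le (by positivity) (by positivity) h_grad
    ((abs_norm s).symm ▸ h.norm_mul_norm_le hσ.norm_mul_norm_le)).trans_eq ?_
  congr 1
  ring

theorem exists_frequency_splitting (h : HasRadialSymbol σ φ z) (hσ : IsResolventSymbol C s σ)
    (hs : 0 ≤ s.re) (him : s.im ≠ 0) {lam : ℝ} (hlam : 1 < lam) :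
    ∃ zH zA : L2, z = zH + zA ∧
      IsHighFrequency (lam * |s.im|) zH ∧ IsLowFrequency (lam * |s.im|) zA ∧
      (∀ p : ℕ, p ≤ 2 → gradNorm p zH ≤ ENNReal.ofReal (3 * C * (lam / (lam - 1)) *
        (‖s‖ / s.im) ^ 2 * (lam * |s.im|) ^ ((p : ℤ) - 2) * ‖φ‖)) ∧
      (∀ p : ℕ, 2 ≤ p → gradNorm p zA ≤ ENNReal.ofReal (3 * C * ((1 + ‖s‖) / (1 + s.re)) *
        (Real.sqrt 3 * lam * |s.im|) ^ ((p : ℤ) - 2) * ‖φ‖)) ∧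
      (∀ p : ℕ, p ≤ 1 → gradNorm p zA ≤ ENNReal.ofReal (3 * C * lam ^ (2 - (p : ℤ)) *
        ((1 + ‖s‖) / (1 + s.re)) * (Real.sqrt 3 * lam * |s.im|) ^ ((p : ℤ) - 2) * ‖φ‖)) := by
  have hC := hσ.nonneg
  have : 0 < lam - 1 := sub_pos.2 hlam
  have h_high : MeasurableSet (Set.Ici (lam * |s.im|)) := measurableSet_Ici
  refine ⟨_, _, (bandPass_add_bandPass_compl h_high z).symm,
    (h.bandPass h_high).isHighFrequency fun k hk => Set.indicator_of_notMem hk.not_ge _,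
    (h.bandPass h_high.compl).isLowFrequency fun k hk =>
      Set.indicator_of_notMem (not_not_intro hk) _,
    fun p hp => ?_, fun p hp => ?_, fun p hp => ?_⟩
  · refine h.gradNorm_bandPass_le h_high (by positivity) fun k hk _ =>
      (hσ.pow_mul_norm_le_of_high him hlam hk hp).trans ?_
    gcongr
    exact le_mul_of_one_le_left hC (by norm_num)
  · refine h.gradNorm_bandPass_le h_high.compl (by positivity) fun k hk hk₀ =>
      (hσ.pow_mul_norm_le_of_low hs hk₀ (not_le.1 (Set.notMem_of_mem_compl hk)).le hp).trans ?_
    gcongr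
    norm_num
  · exact h.gradNorm_bandPass_le h_high.compl (by positivity) fun k _ hk₀ =>
      hσ.pow_mul_norm_le_of_low_of_le_one hs him (one_pos.trans hlam) hk₀ hp

end HasRadialSymbol

end ResolventSymbols

section HalfLine

variable {E : Type*} [NormedAddCommGroup E] {a : ℝ}

theorem integrableOn_Ioi_of_eventually_eq_zero {g : ℝ → E} (hg : ContinuousOn g (Set.Ici a))
    (h₀ : ∀ᶠ r in Filter.atTop, g r = 0) : IntegrableOn g (Set.Ioi a) := by
  obtain ⟨L, hL⟩ := h₀.exists_forall_of_atTop
  have h_int : IntegrableOn g (Set.Icc a L) :=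
    (hg.mono Set.Icc_subset_Ici_self).integrableOn_compact isCompact_Icc
  refine h_int.of_forall_sdiff_eq_zero measurableSet_Ioi fun r ⟨hr, hr'⟩ => hL r ?_
  by_contra! hlt
  exact hr' ⟨hr.le, hlt.le⟩

theorem exists_norm_le_of_eventually_eq_zero {g : ℝ → E} (hg : ContinuousOn g (Set.Ici a))
    (h₀ : ∀ᶠ r in Filter.atTop, g r = 0) : ∃ B, 0 ≤ B ∧ ∀ r, a ≤ r → ‖g r‖ ≤ B := by
  obtain ⟨L, hL⟩ := h₀.exists_forall_of_atTop
  obtain ⟨B, hB⟩ := (isCompact_Icc (a := a) (b := L)).exists_bound_of_continuousOn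
    (hg.mono Set.Icc_subset_Ici_self)
  refine ⟨max B 0, le_max_right _ _, fun r hr => ?_⟩
  rcases le_total r L with hrL | hLr
  · exact (hB r ⟨hr, hrL⟩).trans (le_max_left _ _)
  · rw [hL r hLr, norm_zero]
    exact le_max_right _ _

theorem eventually_eq_zero_of_hasDerivAt [NormedSpace ℝ E] {f f' : ℝ → E}
    (hf : ∀ r, a < r → HasDerivAt f (f' r) r) (h₀ : ∀ᶠ r in Filter.atTop, f r = 0) :
    ∀ᶠ r in Filter.atTop, f' r = 0 := by
  obtain ⟨L, hL⟩ := h₀.exists_forall_of_atTop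
  filter_upwards [Filter.eventually_gt_atTop L, Filter.eventually_gt_atTop a] with r hLr har
  refine (hf r har).unique ((hasDerivAt_const r (0 : E)).congr_of_eventuallyEq ?_)
  filter_upwards [Ioi_mem_nhds hLr] with t ht using hL t ht.le

theorem hasDerivAt_derivWithin_Ici [NormedSpace ℝ E] {f : ℝ → E} {r : ℝ}
    (hf : DifferentiableOn ℝ f (Set.Ici a)) (hr : a < r) :
    HasDerivAt f (derivWithin f (Set.Ici a) r) r :=
  (hf r hr.le).hasDerivWithinAt.hasDerivAt (Ici_mem_nhds hr)

theorem integral_Ioi_deriv_mul_of_eventually_eq_zero {A : Type*} [NormedRing A]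
    [NormedAlgebra ℝ A] [CompleteSpace A] {u u' v v' : ℝ → A}
    (hu : ∀ r, HasDerivAt u (u' r) r) (hu' : Continuous u')
    (hv : ∀ r, a < r → HasDerivAt v (v' r) r) (hv_cont : ContinuousOn v (Set.Ici a))
    (hv' : ContinuousOn v' (Set.Ici a)) (h₀ : ∀ᶠ r in Filter.atTop, v r = 0) :
    ∫ r in Set.Ioi a, u' r * v r = -(u a * v a) - ∫ r in Set.Ioi a, u r * v' r := by
  have hu_cont : Continuous u := continuous_iff_continuousAt.2 fun r => (hu r).continuousAt
  have h_int : IntegrableOn (fun r => u' r * v r) (Set.Ioi a) :=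
    integrableOn_Ioi_of_eventually_eq_zero (hu'.continuousOn.mul hv_cont)
      (h₀.mono fun r hr => by rw [hr, mul_zero])
  have h_int' : IntegrableOn (fun r => u r * v' r) (Set.Ioi a) :=
    integrableOn_Ioi_of_eventually_eq_zero (hu_cont.continuousOn.mul hv')
      ((eventually_eq_zero_of_hasDerivAt hv h₀).mono fun r hr => by rw [hr, mul_zero])
  have h_zero : Filter.Tendsto (u * v) (nhdsWithin a (Set.Ioi a)) (nhds (u a * v a)) :=
    (hu_cont.continuousOn.mul hv_cont a Set.self_mem_Ici).mono Set.Ioi_subset_Ici_self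
  have h_infty : Filter.Tendsto (u * v) Filter.atTop (nhds 0) :=
    tendsto_const_nhds.congr' (h₀.mono fun r hr => by rw [Pi.mul_apply, hr, mul_zero])
  rw [eq_sub_iff_add_eq, ← integral_add h_int h_int', ← zero_sub]
  exact integral_Ioi_deriv_mul_eq_sub (fun r _ => hu r) hv (h_int.add h_int') h_zero h_infty

variable [NormedSpace ℝ E] {q : ℝ → E}

theorem eventually_integral_Ioi_eq_zero (h₀ : ∀ᶠ r in Filter.atTop, q r = 0) :
    ∀ᶠ t in Filter.atTop, ∫ r in Set.Ioi t, q r = 0 := by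
  filter_upwards [Filter.eventually_forall_ge_atTop.2 h₀] with t ht
  exact setIntegral_eq_zero_of_forall_eq_zero fun r hr => ht r (le_of_lt hr)

variable [CompleteSpace E]

theorem hasDerivAt_integral_Ioi {t : ℝ} (hq : IntegrableOn q (Set.Ioi a)) (ht : a < t)
    (hqt : ContinuousAt q t) :
    HasDerivAt (fun t => ∫ r in Set.Ioi t, q r) (-q t) t := by
  have h_int : IntervalIntegrable q volume a t :=
    (intervalIntegrable_iff_integrableOn_Ioc_of_le ht.le).2 (hq.mono_set Set.Ioc_subset_Ioi_self)
  have h_meas : StronglyMeasurableAtFilter q (nhds t) :=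
    ⟨Set.Ioi a, Ioi_mem_nhds ht, hq.aestronglyMeasurable⟩
  refine ((intervalIntegral.integral_hasDerivAt_right h_int h_meas hqt).const_sub
    (∫ r in Set.Ioi a, q r)).congr_of_eventuallyEq ?_
  filter_upwards [Ioi_mem_nhds ht] with u hu
  rw [← intervalIntegral.integral_Ioi_sub_Ioi hq hu.le, sub_sub_cancel]

end HalfLine

section ProjectionSlice

variable {F : Type*} [NormedAddCommGroup F]

section PolarCoordinates

variable [NormedSpace ℝ F]

theorem integral_Ioi_smul_comp_sqrt (z : ℝ) (h : ℝ → F) :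
    ∫ r in Set.Ioi 0, r • h (Real.sqrt (z ^ 2 + r ^ 2)) = ∫ t in Set.Ioi |z|, t • h t := by
  have h_cont : Continuous fun r : ℝ => Real.sqrt (z ^ 2 + r ^ 2) := by fun_prop
  have h_mono : StrictMonoOn (fun r : ℝ => Real.sqrt (z ^ 2 + r ^ 2)) (Set.Ici 0) :=
    fun r (hr : 0 ≤ r) r' _ hlt => Real.sqrt_lt_sqrt (by positivity) (by gcongr)
  have h_top : Filter.Tendsto (fun r : ℝ => Real.sqrt (z ^ 2 + r ^ 2)) Filter.atTop Filter.atTop :=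
    Filter.tendsto_atTop_mono (fun r => Real.le_sqrt_of_sq_le (le_add_of_nonneg_left (sq_nonneg z)))
      Filter.tendsto_id
  have h_image : (fun r : ℝ => Real.sqrt (z ^ 2 + r ^ 2)) '' Set.Ioi 0 = Set.Ioi |z| := by
    rw [h_cont.continuousOn.image_Ioi_of_strictMonoOn h_mono h_top]
    simp [Real.sqrt_sq_eq_abs]
  have h_deriv (r : ℝ) (hr : r ∈ Set.Ioi 0) :
      HasDerivWithinAt (fun r => Real.sqrt (z ^ 2 + r ^ 2)) (r / Real.sqrt (z ^ 2 + r ^ 2))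
        (Set.Ioi 0) r := by
    have hr₀ : r ≠ 0 := ne_of_gt hr
    refine ((((hasDerivAt_pow 2 r).const_add (z ^ 2)).sqrt
      (by positivity)).congr_deriv ?_).hasDerivWithinAt
    simp [mul_div_mul_left]
  rw [← h_image, integral_image_eq_integral_abs_deriv_smul measurableSet_Ioi h_deriv
    (h_mono.injOn.mono Set.Ioi_subset_Ici_self)]
  refine setIntegral_congr_fun measurableSet_Ioi fun r (hr : 0 < r) => ?_
  have h_pos : 0 < Real.sqrt (z ^ 2 + r ^ 2) := by positivity
  simp only [smul_smul]
  rw [abs_of_pos (by positivity), div_mul_cancel₀ _ h_pos.ne']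

theorem integral_comp_sqrt_sq_add_norm_sq (z : ℝ) (h : ℝ → F) :
    ∫ y : EuclideanSpace ℝ (Fin 2), h (Real.sqrt (z ^ 2 + ‖y‖ ^ 2)) =
      (2 * Real.pi) • ∫ t in Set.Ioi |z|, t • h t := by
  have h_ball : (volume : Measure (EuclideanSpace ℝ (Fin 2))).real (Metric.ball 0 1) = Real.pi := by
    simp [Measure.real, EuclideanSpace.volume_ball_fin_two, Real.pi_pos.le]
  rw [integral_fun_norm_addHaar volume fun r => h (Real.sqrt (z ^ 2 + r ^ 2)), h_ball,
    ← integral_Ioi_smul_comp_sqrt, ← smul_assoc, finrank_euclideanSpace_fin]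
  simp

end PolarCoordinates

/-- Cartesian coordinates `ℝ × ℝ² ≃ ℝ³`, slicing `ℝ³` into planes orthogonal to the first axis. -/
def sliceEquiv : ℝ × EuclideanSpace ℝ (Fin 2) ≃ᵐ E3 :=
  (((MeasurableEquiv.refl ℝ).prodCongr (MeasurableEquiv.toLp 2 (Fin 2 → ℝ)).symm).trans
    (MeasurableEquiv.piFinSuccAbove (fun _ : Fin 3 => ℝ) 0).symm).trans
      (MeasurableEquiv.toLp 2 (Fin 3 → ℝ))

theorem measurePreserving_sliceEquiv :
    MeasurePreserving sliceEquiv ((volume : Measure ℝ).prod volume) volume :=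
  (((MeasurePreserving.id volume).prod
      (EuclideanSpace.volume_preserving_symm_measurableEquiv_toLp (Fin 2))).trans
    ((volume_preserving_piFinSuccAbove (fun _ : Fin 3 => ℝ) 0).symm _)).trans
      (PiLp.volume_preserving_toLp (Fin 3))

theorem sliceEquiv_apply_zero (p : ℝ × EuclideanSpace ℝ (Fin 2)) : sliceEquiv p 0 = p.1 := rfl

theorem norm_sliceEquiv (p : ℝ × EuclideanSpace ℝ (Fin 2)) :
    ‖sliceEquiv p‖ = Real.sqrt (p.1 ^ 2 + ‖p.2‖ ^ 2) := by
  rw [EuclideanSpace.norm_eq, EuclideanSpace.norm_sq_eq, Fin.sum_univ_succ]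
  simp only [sliceEquiv_apply_zero, Real.norm_eq_abs, sq_abs]
  rfl

variable [NormedSpace ℂ F]

theorem fourier_single_zero {f : E3 → F} (hf : Integrable f) (t : ℝ) :
    𝓕 f (EuclideanSpace.single 0 t) =
      𝓕 (fun a : ℝ => ∫ y : EuclideanSpace ℝ (Fin 2), f (sliceEquiv (a, y))) t := by
  have h_int := (measurePreserving_sliceEquiv.integrable_comp_emb
    sliceEquiv.measurableEmbedding).2
      ((Real.fourierIntegral_convergent_iff (EuclideanSpace.single 0 t)).2 hf)
  rw [Real.fourier_eq, Real.fourier_real_eq, ← measurePreserving_sliceEquiv.integral_comp']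
  refine (integral_prod _ h_int).trans ?_
  congr 1 with a
  simp only [Function.comp_apply, EuclideanSpace.inner_single_right, sliceEquiv_apply_zero,
    Circle.smul_def, conj_trivial, integral_smul, mul_comm t a]

theorem fourier_comp_abs {Q : ℝ → F} (hQ : Integrable fun a => Q |a|) (t : ℝ) :
    𝓕 (fun a => Q |a|) t =
      (2 : ℝ) • ∫ a in Set.Ioi 0, Real.cos (2 * Real.pi * t * a) • Q a := by
  have h_even : 𝓕 (fun a => Q |a|) (-t) = 𝓕 (fun a => Q |a|) t := by
    rw [← Real.fourierInv_eq_fourier_neg, Real.fourierInv_eq_fourier_comp_neg]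
    simp only [abs_neg]
  have h_int (t : ℝ) : Integrable fun a => Real.fourierChar (-(a * t)) • Q |a| := by
    simpa [mul_comm t] using (Real.fourierIntegral_convergent_iff t).2 hQ
  have h_char (a : ℝ) : (Real.fourierChar (-(a * t)) : ℂ) + Real.fourierChar (-(a * -t)) =
      ((2 * Real.cos (2 * Real.pi * t * |a|) : ℝ) : ℂ) := by
    rw [← Real.cos_abs, abs_mul, abs_abs, ← abs_mul, Real.cos_abs]
    simp only [Real.fourierChar_apply]
    push_cast
    rw [Complex.two_cos, add_comm]
    congr 2 <;> ring
  have h_polar := integral_fun_norm_addHaar (volume : Measure ℝ)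
    fun a : ℝ => (2 * Real.cos (2 * Real.pi * t * a)) • Q a
  simp only [Module.finrank_self, tsub_self, pow_zero, one_smul, Real.norm_eq_abs,
    Measure.real, Real.volume_ball, mul_one, ENNReal.toReal_ofReal zero_le_two] at h_polar
  refine smul_right_injective F (two_ne_zero (α := ℝ)) ?_
  calc (2 : ℝ) • 𝓕 (fun a => Q |a|) t
      = ∫ a, (2 * Real.cos (2 * Real.pi * t * |a|)) • Q |a| := by
        nth_rewrite 1 [two_smul, ← h_even]
        rw [add_comm, Real.fourier_real_eq, Real.fourier_real_eq,
          ← integral_add (h_int t) (h_int (-t))]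
        congr 1 with a
        rw [Circle.smul_def, Circle.smul_def, ← add_smul, h_char, Complex.coe_smul]
    _ = (2 : ℝ) • (2 : ℝ) • ∫ a in Set.Ioi 0, Real.cos (2 * Real.pi * t * a) • Q a := by
        rw [h_polar]
        simp only [mul_smul, integral_smul]

end ProjectionSlice

section RadialKernels

/-- The radial function `x ↦ q(‖x‖) / (4π‖x‖)` on `ℝ³`; `kernel` and `cutKernel` have this form. -/
def radialKernel (q : ℝ → ℂ) (x : E3) : ℂ :=
  q ‖x‖ / (4 * Real.pi * ‖x‖)

/-- The sine transform `k ↦ ∫₀^∞ (sin (kr) / k) q(r) dr`, which is the Fourier transform of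
`radialKernel q` at angular frequency `k`. -/
def sineTransform (q : ℝ → ℂ) (k : ℝ) : ℂ :=
  ∫ r in Set.Ioi 0, ((Real.sin (k * r) / k : ℝ) : ℂ) * q r

variable {q : ℝ → ℂ}

theorem integrable_radialKernel (hq : ContinuousOn q (Set.Ici 0))
    (h₀ : ∀ᶠ r in Filter.atTop, q r = 0) : Integrable (radialKernel q) := by
  have h_radial : IntegrableOn (fun r : ℝ => (r / (4 * Real.pi) : ℂ) * q r) (Set.Ioi 0) :=
    integrableOn_Ioi_of_eventually_eq_zero (by fun_prop) (h₀.mono fun r hr => by rw [hr, mul_zero])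
  refine (integrable_fun_norm_addHaar volume (f := fun r : ℝ => q r / (4 * Real.pi * r))).2
    (h_radial.congr_fun (fun r (hr : 0 < r) => ?_) measurableSet_Ioi)
  have hr₀ : (r : ℂ) ≠ 0 := Complex.ofReal_ne_zero.2 hr.ne'
  simp only [finrank_euclideanSpace, Fintype.card_fin, Complex.real_smul]
  push_cast
  field_simp

theorem memLp_two_radialKernel (hq : ContinuousOn q (Set.Ici 0))
    (h₀ : ∀ᶠ r in Filter.atTop, q r = 0) : MemLp (radialKernel q) 2 := by
  have h_meas := (integrable_radialKernel hq h₀).aestronglyMeasurable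
  rw [memLp_two_iff_integrable_sq_norm h_meas]
  have h_radial : IntegrableOn (fun r : ℝ => ‖q r‖ ^ 2 / (4 * Real.pi) ^ 2) (Set.Ioi 0) :=
    integrableOn_Ioi_of_eventually_eq_zero (by fun_prop) (h₀.mono fun r hr => by simp [hr])
  refine (integrable_fun_norm_addHaar volume
    (f := fun r : ℝ => ‖q r / (4 * Real.pi * r)‖ ^ 2)).2
    (h_radial.congr_fun (fun r (hr : 0 < r) => ?_) measurableSet_Ioi)
  simp only [finrank_euclideanSpace, Fintype.card_fin, norm_div, norm_mul, Complex.norm_real,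
    Real.norm_of_nonneg hr.le, Real.norm_of_nonneg Real.pi_nonneg, Complex.norm_ofNat, smul_eq_mul]
  field_simp

theorem integral_radialKernel_slice (q : ℝ → ℂ) (a : ℝ) :
    ∫ y : EuclideanSpace ℝ (Fin 2), radialKernel q (sliceEquiv (a, y)) =
      (∫ r in Set.Ioi |a|, q r) / 2 := by
  simp only [radialKernel, norm_sliceEquiv]
  rw [integral_comp_sqrt_sq_add_norm_sq a fun r => q r / (4 * Real.pi * r), ← integral_smul,
    ← integral_div]
  refine setIntegral_congr_fun measurableSet_Ioi fun r hr => ?_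
  have hr₀ : (r : ℂ) ≠ 0 := Complex.ofReal_ne_zero.2 ((abs_nonneg a).trans_lt hr).ne'
  simp only [Complex.real_smul]
  push_cast
  field_simp
  ring

theorem hasDerivAt_sin_mul_div {k : ℝ} (hk : k ≠ 0) (r : ℝ) :
    HasDerivAt (fun r : ℝ => ((Real.sin (k * r) / k : ℝ) : ℂ)) (Real.cos (k * r) : ℂ) r := by
  refine ((((hasDerivAt_id' r).const_mul k).sin.div_const k).congr_deriv ?_).ofReal_comp
  field_simp

theorem integral_cos_mul_integral_Ioi {k : ℝ} (hk : k ≠ 0) (hq : ContinuousOn q (Set.Ici 0))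
    (h₀ : ∀ᶠ r in Filter.atTop, q r = 0) :
    ∫ a in Set.Ioi 0, (Real.cos (k * a) : ℂ) * ∫ r in Set.Ioi a, q r = sineTransform q k := by
  have h_int := integrableOn_Ioi_of_eventually_eq_zero hq h₀
  rw [integral_Ioi_deriv_mul_of_eventually_eq_zero (hasDerivAt_sin_mul_div hk) (by fun_prop)
    (fun a (ha : 0 < a) => hasDerivAt_integral_Ioi h_int ha (hq.continuousAt (Ici_mem_nhds ha)))
    h_int.continuousOn_Ici_primitive_Ioi hq.neg (eventually_integral_Ioi_eq_zero h₀)]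
  simp [sineTransform, integral_neg]

theorem fourier_radialKernel_single_zero {t : ℝ} (ht : t ≠ 0) (hq : ContinuousOn q (Set.Ici 0))
    (h₀ : ∀ᶠ r in Filter.atTop, q r = 0) :
    𝓕 (radialKernel q) (EuclideanSpace.single 0 t) = sineTransform q (2 * Real.pi * t) := by
  have h_int := integrable_radialKernel hq h₀
  have h_slice : Integrable fun a : ℝ => (∫ r in Set.Ioi |a|, q r) / 2 := by
    simp_rw [← integral_radialKernel_slice]
    exact ((measurePreserving_sliceEquiv.integrable_comp_emb
      sliceEquiv.measurableEmbedding).2 h_int).integral_prod_left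
  rw [fourier_single_zero h_int]
  simp_rw [integral_radialKernel_slice]
  rw [fourier_comp_abs (Q := fun a => (∫ r in Set.Ioi a, q r) / 2) h_slice, ← integral_smul,
    ← integral_cos_mul_integral_Ioi (by positivity) hq h₀]
  congr 1 with a
  simp only [Complex.real_smul]
  push_cast
  ring

theorem fourier_radialKernel {ξ : E3} (hξ : ξ ≠ 0) (hq : ContinuousOn q (Set.Ici 0))
    (h₀ : ∀ᶠ r in Filter.atTop, q r = 0) :
    𝓕 (radialKernel q) ξ = sineTransform q (2 * Real.pi * ‖ξ‖) := by
  have h_norm : ‖ξ‖ = ‖(EuclideanSpace.single 0 ‖ξ‖ : E3)‖ := by simp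
  let A : E3 ≃ₗᵢ[ℝ] E3 := (Submodule.span ℝ {ξ - EuclideanSpace.single 0 ‖ξ‖})ᗮ.reflection
  have h_radial : radialKernel q ∘ A = radialKernel q := by
    ext x
    simp only [Function.comp_apply, radialKernel, A.norm_map]
  rw [← h_radial, Real.fourier_comp_linearIsometry, Submodule.reflection_sub h_norm,
    fourier_radialKernel_single_zero (norm_ne_zero_iff.2 hξ) hq h₀]

end RadialKernels

section LaplaceTransform

/-- The Laplace transform `s ↦ ∫₀^∞ e^{-sr} f(r) dr`. -/
def laplaceTransform (f : ℝ → ℂ) (s : ℂ) : ℂ :=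
  ∫ r in Set.Ioi (0 : ℝ), Complex.exp (-s * r) * f r

theorem integrableOn_exp_mul {f : ℝ → ℂ} (s : ℂ) (hf : ContinuousOn f (Set.Ici 0))
    (h₀ : ∀ᶠ r in Filter.atTop, f r = 0) :
    IntegrableOn (fun r : ℝ => Complex.exp (-s * r) * f r) (Set.Ioi 0) :=
  integrableOn_Ioi_of_eventually_eq_zero (by fun_prop) (h₀.mono fun r hr => by rw [hr, mul_zero])

theorem laplaceTransform_add {f g : ℝ → ℂ} (s : ℂ) (hf : ContinuousOn f (Set.Ici 0))
    (hf₀ : ∀ᶠ r in Filter.atTop, f r = 0) (hg : ContinuousOn g (Set.Ici 0))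
    (hg₀ : ∀ᶠ r in Filter.atTop, g r = 0) :
    laplaceTransform (fun r => f r + g r) s = laplaceTransform f s + laplaceTransform g s := by
  simp only [laplaceTransform, mul_add]
  exact integral_add (integrableOn_exp_mul s hf hf₀) (integrableOn_exp_mul s hg hg₀)

theorem laplaceTransform_const_mul (c : ℂ) (f : ℝ → ℂ) (s : ℂ) :
    laplaceTransform (fun r => c * f r) s = c * laplaceTransform f s := by
  simp only [laplaceTransform, ← integral_const_mul, mul_left_comm c]

theorem mul_laplaceTransform {f f' : ℝ → ℂ} (s : ℂ) (hf : ∀ r, 0 < r → HasDerivAt f (f' r) r)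
    (hf_cont : ContinuousOn f (Set.Ici 0)) (hf' : ContinuousOn f' (Set.Ici 0))
    (h₀ : ∀ᶠ r in Filter.atTop, f r = 0) :
    s * laplaceTransform f s = f 0 + laplaceTransform f' s := by
  have h_exp (r : ℝ) : HasDerivAt (fun r : ℝ => Complex.exp (-s * r))
      (-s * Complex.exp (-s * r)) r := by
    simpa [mul_comm] using ((Complex.ofRealCLM.hasDerivAt (x := r)).const_mul (-s)).cexp
  have h_parts := integral_Ioi_deriv_mul_of_eventually_eq_zero h_exp (by fun_prop) hf hf_cont hf' h₀
  simp only [mul_assoc, integral_const_mul, Complex.ofReal_zero, mul_zero, Complex.exp_zero,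
    one_mul] at h_parts
  simp only [laplaceTransform]
  linear_combination -h_parts

theorem integrableOn_mul_exp_neg_mul {a : ℝ} (ha : 0 ≤ a) :
    IntegrableOn (fun r => a * Real.exp (-a * r)) (Set.Ioi 0) := by
  rcases ha.eq_or_lt with rfl | ha
  · simp
  · exact (integrableOn_exp_mul_Ioi (neg_lt_zero.2 ha) 0).const_mul a

theorem integral_mul_exp_neg_mul_le_one {a : ℝ} (ha : 0 ≤ a) :
    ∫ r in Set.Ioi 0, a * Real.exp (-a * r) ≤ 1 := by
  rcases ha.eq_or_lt with rfl | ha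
  · simp
  · rw [integral_const_mul, integral_exp_mul_Ioi (neg_lt_zero.2 ha)]
    simp [ha.ne']

theorem one_add_mul_exp_neg_mul_le {a b B r : ℝ} (ha : 0 ≤ a) (hr : 0 ≤ r) (hb : 0 ≤ b)
    (hB : b ≤ B) :
    (1 + a) * (Real.exp (-a * r) * b) ≤ b + B * (a * Real.exp (-a * r)) :=
  calc (1 + a) * (Real.exp (-a * r) * b)
      = Real.exp (-a * r) * b + b * (a * Real.exp (-a * r)) := by ring
    _ ≤ b + B * (a * Real.exp (-a * r)) := by
        gcongr
        exact mul_le_of_le_one_left hb (Real.exp_le_one_iff.2 (by nlinarith))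

theorem exists_norm_laplaceTransform_le {g : ℝ → ℝ} (hg : ContinuousOn g (Set.Ici 0))
    (h₀ : ∀ᶠ r in Filter.atTop, g r = 0) :
    ∃ M, 0 ≤ M ∧ ∀ s : ℂ, 0 ≤ s.re → ∀ f : ℝ → ℂ, (∀ r, 0 < r → ‖f r‖ ≤ g r) →
      ‖laplaceTransform f s‖ ≤ M / (1 + s.re) := by
  obtain ⟨B, hB, hgB⟩ := exists_norm_le_of_eventually_eq_zero hg h₀
  have h_int := integrableOn_Ioi_of_eventually_eq_zero hg h₀
  refine ⟨(∫ r in Set.Ioi 0, ‖g r‖) + B, by positivity, fun s hs f hf => ?_⟩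
  have h_bound (r : ℝ) (hr : 0 < r) : ‖((1 + s.re : ℝ) : ℂ) * (Complex.exp (-s * r) * f r)‖ ≤
      ‖g r‖ + B * (s.re * Real.exp (-s.re * r)) := by
    have h_norm : ‖Complex.exp (-s * r)‖ = Real.exp (-s.re * r) := by simp [Complex.norm_exp]
    rw [norm_mul, norm_mul, h_norm, Complex.norm_of_nonneg (by positivity)]
    refine le_trans ?_ (one_add_mul_exp_neg_mul_le hs hr.le (norm_nonneg _) (hgB r hr.le))
    gcongr
    exact (hf r hr).trans (Real.le_norm_self _)
  rw [le_div_iff₀' (by positivity)]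
  calc (1 + s.re) * ‖laplaceTransform f s‖
      = ‖∫ r in Set.Ioi (0 : ℝ), ((1 + s.re : ℝ) : ℂ) * (Complex.exp (-s * r) * f r)‖ := by
        rw [integral_const_mul, norm_mul, Complex.norm_of_nonneg (by positivity)]
        rfl
    _ ≤ ∫ r in Set.Ioi 0, (‖g r‖ + B * (s.re * Real.exp (-s.re * r))) :=
        norm_integral_le_of_norm_le (h_int.norm.add ((integrableOn_mul_exp_neg_mul hs).const_mul B))
          ((ae_restrict_mem measurableSet_Ioi).mono h_bound)
    _ ≤ (∫ r in Set.Ioi 0, ‖g r‖) + B := by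
        rw [integral_add h_int.norm ((integrableOn_mul_exp_neg_mul hs).const_mul B),
          integral_const_mul]
        gcongr
        exact mul_le_of_le_one_right hB (integral_mul_exp_neg_mul_le_one hs)

end LaplaceTransform

section DampedSineTransform

variable {k : ℝ}

theorem hasDerivAt_cos_mul (hk : k ≠ 0) (r : ℝ) :
    HasDerivAt (fun r : ℝ => (Real.cos (k * r) : ℂ))
      (-(k : ℂ) ^ 2 * ((Real.sin (k * r) / k : ℝ) : ℂ)) r := by
  refine (((hasDerivAt_id' r).const_mul k).cos.ofReal_comp).congr_deriv ?_
  have hk' : (k : ℂ) ≠ 0 := Complex.ofReal_ne_zero.2 hk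
  push_cast
  field_simp

theorem norm_cos_mul_le (k r : ℝ) (w : ℂ) : ‖(Real.cos (k * r) : ℂ) * w‖ ≤ ‖w‖ := by
  rw [norm_mul, Complex.norm_real]
  exact mul_le_of_le_one_left (norm_nonneg _) (Real.abs_cos_le_one _)

theorem norm_sin_div_mul_le {r : ℝ} (k : ℝ) (hr : 0 ≤ r) (w : ℂ) :
    ‖((Real.sin (k * r) / k : ℝ) : ℂ) * w‖ ≤ r * ‖w‖ := by
  rw [norm_mul, Complex.norm_real, Real.norm_eq_abs, abs_div]
  gcongr
  refine div_le_of_le_mul₀ (abs_nonneg k) hr (Real.abs_sin_le_abs.trans_eq ?_)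
  rw [abs_mul, abs_of_nonneg hr, mul_comm]

theorem sineTransform_exp_mul (m : ℝ → ℂ) (s : ℂ) (k : ℝ) :
    sineTransform (fun r => Complex.exp (-s * r) * m r) k =
      laplaceTransform (fun r => ((Real.sin (k * r) / k : ℝ) : ℂ) * m r) s := by
  simp only [sineTransform, laplaceTransform, mul_left_comm]

theorem ofReal_mul_sineTransform_exp_mul (s : ℂ) (hk : k ≠ 0) (m : ℝ → ℂ) :
    k * sineTransform (fun r => Complex.exp (-s * r) * m r) k =
      laplaceTransform (fun r => (Real.sin (k * r) : ℂ) * m r) s := by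
  have hk' : (k : ℂ) ≠ 0 := Complex.ofReal_ne_zero.2 hk
  rw [sineTransform_exp_mul, ← laplaceTransform_const_mul]
  congr 1 with r
  push_cast
  field_simp

variable {m m₁ m₂ : ℝ → ℂ}

theorem mul_sineTransform_exp_mul (s : ℂ) (hk : k ≠ 0) (hm : ∀ r, 0 < r → HasDerivAt m (m₁ r) r)
    (hc : ContinuousOn m (Set.Ici 0)) (hc₁ : ContinuousOn m₁ (Set.Ici 0))
    (h₀ : ∀ᶠ r in Filter.atTop, m r = 0) :
    s * sineTransform (fun r => Complex.exp (-s * r) * m r) k =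
      laplaceTransform (fun r => (Real.cos (k * r) : ℂ) * m r +
        ((Real.sin (k * r) / k : ℝ) : ℂ) * m₁ r) s := by
  rw [sineTransform_exp_mul, mul_laplaceTransform s
    (fun r hr => (hasDerivAt_sin_mul_div hk r).fun_mul (hm r hr)) (by fun_prop) (by fun_prop)
    (h₀.mono fun r hr => by rw [hr, mul_zero])]
  simp

theorem sq_add_sq_mul_sineTransform_exp_mul (s : ℂ) (hk : k ≠ 0)
    (hm : ∀ r, 0 < r → HasDerivAt m (m₁ r) r) (hm₁ : ∀ r, 0 < r → HasDerivAt m₁ (m₂ r) r)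
    (hc : ContinuousOn m (Set.Ici 0)) (hc₁ : ContinuousOn m₁ (Set.Ici 0))
    (hc₂ : ContinuousOn m₂ (Set.Ici 0)) (h₀ : ∀ᶠ r in Filter.atTop, m r = 0) :
    ((k : ℂ) ^ 2 + s ^ 2) * sineTransform (fun r => Complex.exp (-s * r) * m r) k =
      m 0 + laplaceTransform (fun r => 2 * (Real.cos (k * r) : ℂ) * m₁ r +
        ((Real.sin (k * r) / k : ℝ) : ℂ) * m₂ r) s := by
  have h₁ := eventually_eq_zero_of_hasDerivAt hm h₀
  have h₂ := eventually_eq_zero_of_hasDerivAt hm₁ h₁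
  have h_deriv (r : ℝ) (hr : 0 < r) : HasDerivAt
      (fun r => (Real.cos (k * r) : ℂ) * m r + ((Real.sin (k * r) / k : ℝ) : ℂ) * m₁ r)
      (-(k : ℂ) ^ 2 * (((Real.sin (k * r) / k : ℝ) : ℂ) * m r) +
        (2 * (Real.cos (k * r) : ℂ) * m₁ r + ((Real.sin (k * r) / k : ℝ) : ℂ) * m₂ r)) r := by
    refine (((hasDerivAt_cos_mul hk r).fun_mul (hm r hr)).fun_add
      ((hasDerivAt_sin_mul_div hk r).fun_mul (hm₁ r hr))).congr_deriv ?_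
    ring
  have h_first := mul_sineTransform_exp_mul s hk hm hc hc₁ h₀
  have h_second := mul_laplaceTransform s h_deriv (by fun_prop) (by fun_prop)
    (by filter_upwards [h₀, h₁] with r hr hr₁; simp [hr, hr₁])
  rw [← h_first, laplaceTransform_add s (by fun_prop) (h₀.mono fun r hr => by simp [hr])
    (by fun_prop) (by filter_upwards [h₁, h₂] with r hr₁ hr₂; simp [hr₁, hr₂]),
    laplaceTransform_const_mul, ← sineTransform_exp_mul] at h_second
  simp only [mul_zero, Real.cos_zero, Complex.ofReal_one, one_mul, Real.sin_zero, zero_div,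
    Complex.ofReal_zero, zero_mul, add_zero] at h_second
  linear_combination h_second

theorem exists_isResolventSymbol_of_hasDerivAt (hm : ∀ r, 0 < r → HasDerivAt m (m₁ r) r)
    (hm₁ : ∀ r, 0 < r → HasDerivAt m₁ (m₂ r) r) (hc : ContinuousOn m (Set.Ici 0))
    (hc₁ : ContinuousOn m₁ (Set.Ici 0)) (hc₂ : ContinuousOn m₂ (Set.Ici 0))
    (h₀ : ∀ᶠ r in Filter.atTop, m r = 0) :
    ∃ C, 0 < C ∧ ∀ s : ℂ, 0 ≤ s.re →
      IsResolventSymbol C s (sineTransform fun r => Complex.exp (-s * r) * m r) := by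
  have h₁ := eventually_eq_zero_of_hasDerivAt hm h₀
  have h₂ := eventually_eq_zero_of_hasDerivAt hm₁ h₁
  obtain ⟨M, hM, h_M⟩ := exists_norm_laplaceTransform_le (g := fun r => ‖m r‖) (by fun_prop)
    (h₀.mono fun r hr => by rw [hr, norm_zero])
  obtain ⟨M₁, hM₁, h_M₁⟩ := exists_norm_laplaceTransform_le (g := fun r => ‖m r‖ + r * ‖m₁ r‖)
    (by fun_prop) (by filter_upwards [h₀, h₁] with r hr hr₁; simp [hr, hr₁])
  obtain ⟨M₂, hM₂, h_M₂⟩ := exists_norm_laplaceTransform_le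
    (g := fun r => 2 * ‖m₁ r‖ + r * ‖m₂ r‖) (by fun_prop)
    (by filter_upwards [h₁, h₂] with r hr₁ hr₂; simp [hr₁, hr₂])
  refine ⟨1 + M + M₁ + M₂ + ‖m 0‖, by positivity, fun s hs => ⟨fun k hk => ?_, fun k hk => ?_,
    fun k hk => ?_⟩⟩
  · calc k * ‖sineTransform (fun r => Complex.exp (-s * r) * m r) k‖
        = ‖laplaceTransform (fun r => (Real.sin (k * r) : ℂ) * m r) s‖ := by
          rw [← ofReal_mul_sineTransform_exp_mul s hk.ne', norm_mul, Complex.norm_of_nonneg hk.le]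
      _ ≤ M / (1 + s.re) := h_M s hs _ fun r _ => by
          rw [norm_mul, Complex.norm_real]
          exact mul_le_of_le_one_left (norm_nonneg _) (Real.abs_sin_le_one _)
      _ ≤ (1 + M + M₁ + M₂ + ‖m 0‖) / (1 + s.re) := by gcongr; linarith [norm_nonneg (m 0)]
  · rw [← norm_mul, mul_sineTransform_exp_mul s hk.ne' hm hc hc₁ h₀]
    refine (h_M₁ s hs _ fun r hr => norm_add_le_of_le (norm_cos_mul_le k r _)
      (norm_sin_div_mul_le k hr.le _)).trans ?_
    gcongr
    linarith [norm_nonneg (m 0)]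
  · rw [sq_add_sq_mul_sineTransform_exp_mul s hk.ne' hm hm₁ hc hc₁ hc₂ h₀]
    have h_rest := h_M₂ s hs
      (fun r => 2 * (Real.cos (k * r) : ℂ) * m₁ r + ((Real.sin (k * r) / k : ℝ) : ℂ) * m₂ r)
      fun r hr => norm_add_le_of_le (by
        rw [mul_assoc, norm_mul, Complex.norm_ofNat]
        gcongr
        exact norm_cos_mul_le k r _) (norm_sin_div_mul_le k hr.le _)
    have h_div : M₂ / (1 + s.re) ≤ M₂ := div_le_self hM₂ (by linarith)
    linarith [norm_add_le_of_le le_rfl (h_rest.trans h_div) (a₁ := m 0)]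

theorem exists_isResolventSymbol (hm : ContDiffOn ℝ 2 m (Set.Ici 0))
    (h₀ : ∀ᶠ r in Filter.atTop, m r = 0) :
    ∃ C, 0 < C ∧ ∀ s : ℂ, 0 ≤ s.re →
      IsResolventSymbol C s (sineTransform fun r => Complex.exp (-s * r) * m r) := by
  have hm₁ : ContDiffOn ℝ 1 (derivWithin m (Set.Ici 0)) (Set.Ici 0) :=
    hm.derivWithin (uniqueDiffOn_Ici 0) (by norm_num)
  exact exists_isResolventSymbol_of_hasDerivAt
    (fun r => hasDerivAt_derivWithin_Ici (hm.differentiableOn two_ne_zero))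
    (fun r => hasDerivAt_derivWithin_Ici (hm₁.differentiableOn one_ne_zero))
    hm.continuousOn hm₁.continuousOn
    (hm₁.continuousOn_derivWithin (uniqueDiffOn_Ici 0) le_rfl) h₀

end DampedSineTransform

section Convolution

theorem integrable_mul_comp_sub {G A : Type*} [AddGroup G] [MeasurableSpace G] [MeasurableAdd G]
    [MeasurableNeg G] {ν : Measure G} [ν.IsAddLeftInvariant] [ν.IsNegInvariant] [NormedRing A]
    {f K : G → A} (hf : MemLp f 2 ν) (hK : MemLp K 2 ν) (x : G) :
    Integrable (fun t => f t * K (x - t)) ν :=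
  hf.integrable_mul (hK.comp_measurePreserving (Measure.measurePreserving_sub_left ν x))

theorem convConverges_of_memLp_two {K : E3 → ℂ} (hK : MemLp K 2) (φ : L2) : ConvConverges K φ :=
  integrable_mul_comp_sub (Lp.memLp φ) hK

theorem norm_conv_le {K : E3 → ℂ} (hK : MemLp K 2) (φ : L2) (x : E3) :
    ‖conv K φ x‖ ≤ (∫ t, ‖φ t‖ ^ 2) + ∫ t, ‖K t‖ ^ 2 := by
  have h_shift : Integrable fun t => ‖K (x - t)‖ ^ 2 :=
    (hK.comp_measurePreserving
      (Measure.measurePreserving_sub_left volume x)).integrable_norm_pow two_ne_zero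
  rw [← integral_sub_left_eq_self (fun t => ‖K t‖ ^ 2) volume x,
    ← integral_add (integrable_norm_sq φ) h_shift]
  refine norm_integral_le_of_norm_le ((integrable_norm_sq φ).add h_shift) (.of_forall fun t => ?_)
  simp only [ContinuousLinearMap.mul_apply', norm_mul]
  nlinarith [sq_nonneg (‖φ t‖ - ‖K (x - t)‖), sq_nonneg ‖φ t‖, sq_nonneg ‖K (x - t)‖]

theorem memLp_two_of_integrable_of_bounded {α E : Type*} [MeasurableSpace α] {ν : Measure α}
    [NormedAddCommGroup E] {f : α → E} {B : ℝ} (hf : Integrable f ν) (hB : ∀ x, ‖f x‖ ≤ B) :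
    MemLp f 2 ν := by
  rw [memLp_two_iff_integrable_sq_norm hf.aestronglyMeasurable]
  refine (hf.norm.const_mul B).mono' (hf.aestronglyMeasurable.norm.pow 2) (.of_forall fun x => ?_)
  rw [norm_pow, norm_norm, pow_two]
  exact mul_le_mul_of_nonneg_right (hB x) (norm_nonneg _)

theorem memLp_two_conv {K : E3 → ℂ} (hK : Integrable K) (hK₂ : MemLp K 2) {φ : L2}
    (hφ : Integrable φ) : MemLp (conv K φ) 2 :=
  memLp_two_of_integrable_of_bounded (hφ.integrable_convolution _ hK) (norm_conv_le hK₂ φ)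

theorem fourier_conv_ae_eq {K : E3 → ℂ} (hK : Integrable K) (hK₂ : MemLp K 2) {φ : L2}
    (hφ : Integrable φ) :
    (𝓕 (memLp_two_conv hK hK₂ hφ).toLp : L2) =ᵐ[volume] fun ξ => 𝓕 K ξ * (𝓕 φ : L2) ξ := by
  have h_conv := fourier_toLp_ae_eq (hφ.integrable_convolution (ContinuousLinearMap.mul ℂ ℂ) hK)
    (memLp_two_conv hK hK₂ hφ)
  have h_density := fourier_toLp_ae_eq hφ (Lp.memLp φ)
  rw [Lp.toLp_coeFn] at h_density
  filter_upwards [h_conv, h_density] with ξ h_conv h_density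
  exact h_conv.trans (by rw [h_density, Real.fourier_mul_convolution_eq hφ hK, mul_comm])

theorem hasRadialSymbol_conv_radialKernel {q : ℝ → ℂ} (hq : ContinuousOn q (Set.Ici 0))
    (h₀ : ∀ᶠ r in Filter.atTop, q r = 0) {φ : L2} (hφ : Integrable φ) :
    HasRadialSymbol (sineTransform q) φ (memLp_two_conv (integrable_radialKernel hq h₀)
      (memLp_two_radialKernel hq h₀) hφ).toLp := by
  filter_upwards [fourier_conv_ae_eq (integrable_radialKernel hq h₀)
    (memLp_two_radialKernel hq h₀) hφ, Measure.ae_ne volume (0 : E3)] with ξ hξ h_ne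
  rw [hξ, fourier_radialKernel h_ne hq h₀]

variable {R : ℝ} {φ : L2}

theorem SupportedInBall.integrable (hφ : SupportedInBall R φ) : Integrable φ := by
  have h_ball : IntegrableOn φ (Metric.ball 0 R) :=
    have : IsFiniteMeasure ((volume : Measure E3).restrict (Metric.ball 0 R)) :=
      isFiniteMeasure_restrict.2 measure_ball_lt_top.ne
    ((Lp.memLp φ).restrict _).integrable one_le_two
  exact h_ball.integrable_of_ae_notMem_eq_zero hφ

theorem SupportedInBall.ae_mul_comp_sub_eq (hφ : SupportedInBall R φ) {K K' : E3 → ℂ} {x : E3}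
    (hK : ∀ y, ‖y‖ ≤ ‖x‖ + R → K y = K' y) :
    (fun t => φ t * K (x - t)) =ᵐ[volume] fun t => φ t * K' (x - t) := by
  filter_upwards [hφ] with t ht
  by_cases h_ball : t ∈ Metric.ball (0 : E3) R
  · have h_norm : ‖x - t‖ ≤ ‖x‖ + R := (norm_sub_le x t).trans
      (add_le_add_right (mem_ball_zero_iff.1 h_ball).le _)
    rw [hK _ h_norm]
  · rw [ht h_ball, zero_mul, zero_mul]

end Convolution

section CutKernel

variable {μ : ℝ → ℝ}

theorem cutKernel_eq_radialKernel (μ : ℝ → ℝ) (s : ℂ) :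
    cutKernel μ s = radialKernel fun r => Complex.exp (-s * r) * μ r := by
  ext x
  simp only [cutKernel, kernel, radialKernel, div_mul_eq_mul_div]

theorem continuousOn_exp_mul_ofReal (s : ℂ) (hμ : ContinuousOn μ (Set.Ici 0)) :
    ContinuousOn (fun r : ℝ => Complex.exp (-s * r) * (μ r : ℂ)) (Set.Ici 0) := by
  fun_prop

theorem eventually_exp_mul_ofReal_eq_zero (s : ℂ) (h₀ : ∀ᶠ r in Filter.atTop, μ r = 0) :
    ∀ᶠ r : ℝ in Filter.atTop, Complex.exp (-s * r) * (μ r : ℂ) = 0 :=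
  h₀.mono fun r hr => by rw [hr, Complex.ofReal_zero, mul_zero]

theorem memLp_two_cutKernel (s : ℂ) (hμ : ContinuousOn μ (Set.Ici 0))
    (h₀ : ∀ᶠ r in Filter.atTop, μ r = 0) : MemLp (cutKernel μ s) 2 := by
  rw [cutKernel_eq_radialKernel]
  exact memLp_two_radialKernel (continuousOn_exp_mul_ofReal s hμ)
    (eventually_exp_mul_ofReal_eq_zero s h₀)

theorem exists_memLp_two_hasRadialSymbol_conv_cutKernel (s : ℂ) (hμ : ContinuousOn μ (Set.Ici 0))
    (h₀ : ∀ᶠ r in Filter.atTop, μ r = 0) {φ : L2} (hφ : Integrable φ) :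
    ∃ hz : MemLp (conv (cutKernel μ s) φ) 2,
      HasRadialSymbol (sineTransform fun r => Complex.exp (-s * r) * μ r) φ hz.toLp := by
  rw [cutKernel_eq_radialKernel]
  exact ⟨_, hasRadialSymbol_conv_radialKernel (continuousOn_exp_mul_ofReal s hμ)
    (eventually_exp_mul_ofReal_eq_zero s h₀) hφ⟩

theorem cutKernel_eq_kernel {s : ℂ} {y : E3} (h₁ : μ ‖y‖ = 1) : cutKernel μ s y = kernel s y := by
  rw [cutKernel, h₁, Complex.ofReal_one, mul_one]

variable {R : ℝ} {φ : L2}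

theorem convConverges_kernel (s : ℂ) (hφ : SupportedInBall R φ) : ConvConverges (kernel s) φ := by
  intro x
  let bump (r : ℝ) : ℝ := max 0 (min 1 (‖x‖ + R + 1 - r))
  have h_zero : ∀ᶠ r in Filter.atTop, bump r = 0 := by
    filter_upwards [Filter.eventually_ge_atTop (‖x‖ + R + 1)] with r hr
    exact max_eq_left ((min_le_right _ _).trans (by linarith))
  have h_one (y : E3) (hy : ‖y‖ ≤ ‖x‖ + R) : bump ‖y‖ = 1 := by
    simp only [bump]
    rw [min_eq_left (by linarith), max_eq_right zero_le_one]
  exact (integrable_mul_comp_sub (Lp.memLp φ)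
    (memLp_two_cutKernel s (by fun_prop) h_zero) x).congr
    (hφ.ae_mul_comp_sub_eq fun y hy => cutKernel_eq_kernel (h_one y hy))

theorem conv_kernel_eq_conv_cutKernel (s : ℂ) (h₁ : ∀ r, 0 ≤ r → r ≤ 2 * R → μ r = 1)
    (hφ : SupportedInBall R φ) {x : E3} (hx : x ∈ Metric.ball (0 : E3) R) :
    conv (kernel s) φ x = conv (cutKernel μ s) φ x := by
  refine integral_congr_ae (hφ.ae_mul_comp_sub_eq fun y hy => ?_)
  have hx' := mem_ball_zero_iff.1 hx
  exact (cutKernel_eq_kernel (h₁ _ (norm_nonneg y) (by linarith))).symm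

end CutKernel

end HelmholtzSplitting

end

open HelmholtzSplitting in
theorem mainTheorem5_general {R : ℝ} {μ : ℝ → ℝ} (hμ : ContDiffOn ℝ 2 μ (Set.Ici 0))
    (h₁ : ∀ r, 0 ≤ r → r ≤ 2 * R → μ r = 1) (h₀ : ∀ᶠ r in Filter.atTop, μ r = 0) :
    (∀ φ : L2, SupportedInBall R φ → ∀ ζ : ℂ,
      ConvConverges (kernel (starRingEnd ℂ ζ)) φ ∧
      ConvConverges (cutKernel μ (starRingEnd ℂ ζ)) φ ∧
      ∀ x ∈ Metric.ball (0 : E3) R,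
        conv (kernel (starRingEnd ℂ ζ)) φ x = conv (cutKernel μ (starRingEnd ℂ ζ)) φ x) ∧
    (∃ C : ℝ, 0 < C ∧ ∀ φ : L2, Integrable φ → ∀ ζ : ℂ, 0 ≤ ζ.re →
      ∃ hz : MemLp (conv (cutKernel μ (starRingEnd ℂ ζ)) φ) 2 volume,
        weightedNorm ‖ζ‖ hz.toLp ≤ ENNReal.ofReal (C / (1 + ζ.re) * ‖φ‖)) ∧
    (∃ C' : ℝ, 0 < C' ∧ ∀ φ : L2, Integrable φ → ∀ ζ : ℂ, 0 ≤ ζ.re → ζ.im ≠ 0 →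
      ∀ lam : ℝ, 1 < lam → ∃ zH zA : L2,
        (conv (cutKernel μ (starRingEnd ℂ ζ)) φ =ᵐ[volume] fun x => zH x + zA x) ∧
        IsHighFrequency (lam * |ζ.im|) zH ∧ IsLowFrequency (lam * |ζ.im|) zA ∧
        (∀ p : ℕ, p ≤ 2 → gradNorm p zH ≤
          ENNReal.ofReal (C' * (lam / (lam - 1)) * (‖ζ‖ / ζ.im) ^ 2 *
            (lam * |ζ.im|) ^ ((p : ℤ) - 2) * ‖φ‖)) ∧
        (∀ p : ℕ, 2 ≤ p → gradNorm p zA ≤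
          ENNReal.ofReal (C' * ((1 + ‖ζ‖) / (1 + ζ.re)) *
            (Real.sqrt 3 * lam * |ζ.im|) ^ ((p : ℤ) - 2) * ‖φ‖)) ∧
        (∀ p : ℕ, p ≤ 1 → gradNorm p zA ≤
          ENNReal.ofReal (C' * lam ^ (2 - (p : ℤ)) * ((1 + ‖ζ‖) / (1 + ζ.re)) *
            (Real.sqrt 3 * lam * |ζ.im|) ^ ((p : ℤ) - 2) * ‖φ‖))) := by
  obtain ⟨C, hC, hσ⟩ := exists_isResolventSymbol (m := fun r => (μ r : ℂ))
    (Complex.ofRealCLM.contDiff.comp_contDiffOn hμ)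
    (h₀.mono fun r hr => by rw [hr, Complex.ofReal_zero])
  refine ⟨fun φ hφ ζ => ⟨convConverges_kernel _ hφ,
      convConverges_of_memLp_two (memLp_two_cutKernel _ hμ.continuousOn h₀) φ,
      fun x hx => conv_kernel_eq_conv_cutKernel _ h₁ hφ hx⟩,
    ⟨2 * C, by positivity, fun φ hφ ζ hζ => ?_⟩,
    ⟨3 * C, by positivity, fun φ hφ ζ hζ him lam hlam => ?_⟩⟩
  all_goals
    obtain ⟨hz, h_radial⟩ := exists_memLp_two_hasRadialSymbol_conv_cutKernel (φ := φ)
      (starRingEnd ℂ ζ) hμ.continuousOn h₀ hφ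
    have hs : 0 ≤ (starRingEnd ℂ ζ).re := by rwa [Complex.conj_re]
  · refine ⟨hz, ?_⟩
    simpa only [Complex.norm_conj, Complex.conj_re] using h_radial.weightedNorm_le (hσ _ hs) hs
  · have hs_im : (starRingEnd ℂ ζ).im ≠ 0 := by rwa [Complex.conj_im, neg_ne_zero]
    obtain ⟨zH, zA, h_add, h_bounds⟩ := h_radial.exists_frequency_splitting (hσ _ hs) hs hs_im hlam
    refine ⟨zH, zA, ?_, ?_⟩
    · exact hz.coeFn_toLp.symm.trans (h_add ▸ Lp.coeFn_add zH zA)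
    · simpa only [Complex.norm_conj, Complex.conj_re, Complex.conj_im, abs_neg, div_neg, neg_sq]
        using h_bounds

theorem mainTheorem5 (R : ℝ) (hR : 0 < R) (μ : ℝ → ℝ) (Cμ : ℝ)
    (hμ : HelmholtzSplitting.IsCutoff R Cμ μ) :
    -- both convolutions are well defined, and they agree on the ball
    (∀ φ : HelmholtzSplitting.L2, HelmholtzSplitting.SupportedInBall R φ →
      ∀ ζ : ℂ, 0 ≤ ζ.re →
        HelmholtzSplitting.ConvConverges
          (HelmholtzSplitting.kernel (starRingEnd ℂ ζ)) φ ∧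
        HelmholtzSplitting.ConvConverges
          (HelmholtzSplitting.cutKernel μ (starRingEnd ℂ ζ)) φ ∧
        ∀ x ∈ Metric.ball (0 : HelmholtzSplitting.E3) R,
          HelmholtzSplitting.conv (HelmholtzSplitting.kernel (starRingEnd ℂ ζ)) φ x =
            HelmholtzSplitting.conv
              (HelmholtzSplitting.cutKernel μ (starRingEnd ℂ ζ)) φ x) ∧
    -- stability of the cut-off solution
    (∃ C : ℝ, 0 < C ∧
      ∀ φ : HelmholtzSplitting.L2, HelmholtzSplitting.SupportedInBall R φ →
      ∀ ζ : ℂ, 0 ≤ ζ.re →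
        ∃ hz : MemLp (HelmholtzSplitting.conv
            (HelmholtzSplitting.cutKernel μ (starRingEnd ℂ ζ)) φ) 2 volume,
          HelmholtzSplitting.weightedNorm ‖ζ‖ hz.toLp ≤
            ENNReal.ofReal (C / (1 + ζ.re) * ‖φ‖)) ∧
    -- frequency splitting
    (∀ lam0 : ℝ, 1 < lam0 → ∃ C' : ℝ, 0 < C' ∧
      ∀ φ : HelmholtzSplitting.L2, HelmholtzSplitting.SupportedInBall R φ →
      ∀ ζ : ℂ, 0 ≤ ζ.re → ζ.im ≠ 0 → ∀ lam : ℝ, lam0 ≤ lam →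
        ∃ zH zA : HelmholtzSplitting.L2,
          (HelmholtzSplitting.conv
              (HelmholtzSplitting.cutKernel μ (starRingEnd ℂ ζ)) φ
            =ᵐ[volume] fun x => zH x + zA x) ∧
          HelmholtzSplitting.IsHighFrequency (lam * |ζ.im|) zH ∧
          HelmholtzSplitting.IsLowFrequency (lam * |ζ.im|) zA ∧
          (∀ p : ℕ, p ≤ 2 →
            HelmholtzSplitting.gradNorm p zH ≤
              ENNReal.ofReal (C' * (lam / (lam - 1)) * (‖ζ‖ / ζ.im) ^ 2 *
                (lam * |ζ.im|) ^ ((p : ℤ) - 2) * ‖φ‖)) ∧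
          (∀ p : ℕ, 2 ≤ p →
            HelmholtzSplitting.gradNorm p zA ≤
              ENNReal.ofReal (C' * ((1 + ‖ζ‖) / (1 + ζ.re)) *
                (Real.sqrt 3 * lam * |ζ.im|) ^ ((p : ℤ) - 2) * ‖φ‖)) ∧
          (∀ p : ℕ, p ≤ 1 →
            HelmholtzSplitting.gradNorm p zA ≤
              ENNReal.ofReal (C' * lam ^ (2 - (p : ℤ)) * ((1 + ‖ζ‖) / (1 + ζ.re)) *
                (Real.sqrt 3 * lam * |ζ.im|) ^ ((p : ℤ) - 2) * ‖φ‖))) := by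
  obtain ⟨h_conv, ⟨C, hC, h_stable⟩, C', hC', h_split⟩ := mainTheorem5_general
    (hμ.contDiffOn.of_le (by norm_cast)) hμ.eq_one
    ((Filter.eventually_ge_atTop (4 * R)).mono hμ.eq_zero)
  exact ⟨fun φ hφ ζ _ => h_conv φ hφ ζ,
    ⟨C, hC, fun φ hφ ζ hζ => h_stable φ hφ.integrable ζ hζ⟩,
    fun lam0 h0 => ⟨C', hC', fun φ hφ ζ hζ him lam hlam =>
      h_split φ hφ.integrable ζ hζ him lam (h0.trans_le hlam)⟩⟩
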